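/- Let $S$ be an inverse semigroup with unit $1$, that is, a monoid in which every $s$ has exactly one $s^*\in S$ with $ss^*s=s$ and $s^*ss^*=s^*$; write $r\le t$ if $r=tf$ for some idempotent $f\in S$. Let $\beta$ be an action of $S$ on a C$^*$-algebra $A$: closed two-sided ideals $E_s\subseteq A$ and $*$-isomorphisms $\beta_s:E_{s^*}\to E_s$ $(s\in S)$ with $\beta_r\circ\beta_s=\beta_{rs}$ as partially defined maps, and $E_1=A$. Let $\widetilde L=\{x\in\ell^1(S,A): x(s)\in E_s \text{ for all } s\}$, with $$(x*y)(s)=\sum_{rt=s}\beta_r\big(\beta_{r^*}(x(r))\,y(t)\big),\qquad x^*(s)=\beta_s\big(x(s^*)^*\big),$$ and let $L\subseteq\widetilde L$ be the $*$-subalgebra of finitely supported elements, that is, of finite sums $\sum a_s\delta_s$ with $a_s\in E_s$, where $(a\delta_r)(b\delta_t)=\beta_r(\beta_{r^*}(a)b)\delta_{rt}$ and $(a\delta_s)^*=\beta_{s^*}(a^*)\delta_{s^*}$. Let $N$ be the two-sided ideal of the algebra $L$ generated by the elements $a\delta_r-a\delta_t$ with $r\le t$ and $a\in E_r$ (then $a\in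 E_t$). A representation of a $*$-algebra is a $*$-homomorphism into the bounded operators $B(H)$ of a complex Hilbert space $H$. (a) The partial crossed product $A\rtimes_\beta S$ is the enveloping C$^*$-algebra of $L/N$: the completion of $(L/N)/\ker\rho_s$ in the norm induced by $\rho_s(z)=\sup\{\|\rho(z)\|:\rho\text{ a representation of }L/N\}$. (b) A covariant representation of $\beta$ is a triple $(\pi,\nu,H)$ with $H$ a Hilbert space, $\pi:A\to B(H)$ a representation and $\nu$ a multiplicative map from $S$ to the partial isometries of $H$, such that for every $s\in S$ one has $\nu_s\pi(a)\nu_{s^*}=\pi(\beta_s(a))$ for all $a\in E_{s^*}$, and $\nu_s$ has initial space $\overline{\operatorname{span}}\,\pi(E_{s^*})H$ and final space $\overline{\operatorname{span}}\,\pi(E_s)H$. Its integrated form is $(\pi\times\nu)(x)=\sum_{s}\pi(x(s))\nu_s$ for $x\in\widetilde L$. Put $\|x\|_c=\sup\{\|(\pi\times\nu)(x)\|:(\pi,\nu,H)\text{ a covariant representation of }\beta\}$. Sieben's crossed product is the completion of $\widetilde L/\{x:\|x\|_c=0\}$ in the norm induced by $\|\cdot\|_c$. Then the two constructions coincide: $\rho_s(x+N)=\|x\|_c$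 for every $x\in L$, and there is a $*$-isomorphism from $A\rtimes_\beta S$ onto Sieben's crossed product which, for every $x\in L$, sends the class of $x+N$ to the class of $x$. -/

import Mathlib

open scoped ENNReal InnerProductSpace

noncomputable section

/-! ## Inverse semigroups with unit -/

/-- A unital inverse semigroup: every element `r` has exactly one (generalised) inverse `r⁻¹`,
characterised by `r r⁻¹ r = r` and `r⁻¹ r r⁻¹ = r⁻¹`. -/
class InverseMonoid (S : Type*) extends Monoid S, Inv S where
  mul_inv_mul : ∀ r : S, r * r⁻¹ * r = r
  inv_mul_inv : ∀ r : S, r⁻¹ * r * r⁻¹ = r⁻¹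
  inv_unique : ∀ r t : S, r * t * r = r → t * r * t = t → t = r⁻¹

namespace InverseMonoid

variable {S : Type*} [InverseMonoid S]

theorem inv_inv' (r : S) : r⁻¹⁻¹ = r :=
  (inv_unique r⁻¹ r (inv_mul_inv r) (mul_inv_mul r)).symm

theorem inv_of_idem {e : S} (he : e * e = e) : e⁻¹ = e :=
  (inv_unique e e (by rw [he, he]) (by rw [he, he])).symm

theorem one_inv' : (1 : S)⁻¹ = 1 := inv_of_idem (mul_one 1)

theorem idem_mul {e f : S} (he : e * e = e) (hf : f * f = f) : (e * f) * (e * f) = e * f := by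
  set x := (e * f)⁻¹ with hx
  have h1 : (e * f) * x * (e * f) = e * f := mul_inv_mul _
  have h2 : x * (e * f) * x = x := inv_mul_inv _
  have h3 : f * x * e = x := by
    apply inv_unique
    · calc (e * f) * (f * x * e) * (e * f) = e * (f * f) * x * (e * e) * f := by
            simp only [mul_assoc]
        _ = (e * f) * x * (e * f) := by rw [he, hf]; simp only [mul_assoc]
        _ = _ := h1
    · calc (f * x * e) * (e * f) * (f * x * e) = f * (x * ((e * e) * (f * f)) * x) * e := by
            simp only [mul_assoc]
        _ = f * x * e := by rw [he, hf, h2]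
  have hxe : x * e = x := by rw [← h3, mul_assoc, he]
  have hfx : f * x = x := by rw [← h3, ← mul_assoc, ← mul_assoc, hf]
  have hxx : x * x = x := by
    calc x * x = (x * e) * (f * x) := by rw [hxe, hfx]
      _ = x * (e * f) * x := by simp only [mul_assoc]
      _ = x := h2
  have : e * f = x := by
    have := inv_of_idem hxx
    rw [hx, inv_inv'] at this
    exact this
  rw [this, hxx]

theorem idem_comm {e f : S} (he : e * e = e) (hf : f * f = f) : e * f = f * e := by
  have h1 := idem_mul he hf
  have h2 := idem_mul hf he
  have : f * e = (e * f)⁻¹ := by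
    apply inv_unique
    · calc (e * f) * (f * e) * (e * f) = e * (f * f) * (e * e) * f := by simp only [mul_assoc]
        _ = (e * f) * (e * f) := by rw [he, hf]; simp only [mul_assoc]
        _ = _ := h1
    · calc (f * e) * (e * f) * (f * e) = f * (e * e) * (f * f) * e := by simp only [mul_assoc]
        _ = (f * e) * (f * e) := by rw [he, hf]; simp only [mul_assoc]
        _ = _ := h2
  rw [this, inv_of_idem h1]

theorem mul_inv_idem (r : S) : (r * r⁻¹) * (r * r⁻¹) = r * r⁻¹ := by
  rw [← mul_assoc, mul_inv_mul]

theorem inv_mul_idem (r : S) : (r⁻¹ * r) * (r⁻¹ * r) = r⁻¹ * r := by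
  rw [← mul_assoc, inv_mul_inv]

theorem mul_inv_rev' (r s : S) : (r * s)⁻¹ = s⁻¹ * r⁻¹ := by
  have hc := idem_comm (mul_inv_idem s) (inv_mul_idem r)
  symm
  apply inv_unique
  · calc (r * s) * (s⁻¹ * r⁻¹) * (r * s) = r * ((s * s⁻¹) * (r⁻¹ * r)) * s := by
          simp only [mul_assoc]
      _ = (r * r⁻¹ * r) * (s * s⁻¹ * s) := by rw [hc]; simp only [mul_assoc]
      _ = r * s := by rw [mul_inv_mul, mul_inv_mul]
  · calc (s⁻¹ * r⁻¹) * (r * s) * (s⁻¹ * r⁻¹) = s⁻¹ * ((r⁻¹ * r) * (s * s⁻¹)) * r⁻¹ := by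
          simp only [mul_assoc]
      _ = (s⁻¹ * s * s⁻¹) * (r⁻¹ * r * r⁻¹) := by rw [← hc]; simp only [mul_assoc]
      _ = s⁻¹ * r⁻¹ := by rw [inv_mul_inv, inv_mul_inv]

/-- The natural partial order: `s ≤ t` iff `s = t f` for some idempotent `f`. -/
def NatLE (s t : S) : Prop := ∃ f : S, IsIdempotentElem f ∧ s = t * f

theorem NatLE.inv {s t : S} (h : NatLE s t) : NatLE s⁻¹ t⁻¹ := by
  obtain ⟨f, hf, rfl⟩ := h
  have hf' : f * f = f := hf
  refine ⟨t * f * t⁻¹, ?_, ?_⟩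
  · calc (t * f * t⁻¹) * (t * f * t⁻¹) = t * (f * (t⁻¹ * t)) * (f * t⁻¹) := by
          simp only [mul_assoc]
      _ = (t * t⁻¹ * t) * (f * f) * t⁻¹ := by
          rw [idem_comm hf' (inv_mul_idem t)]; simp only [mul_assoc]
      _ = t * f * t⁻¹ := by rw [mul_inv_mul, hf']
  · rw [mul_inv_rev', inv_of_idem hf']
    calc f * t⁻¹ = f * (t⁻¹ * t * t⁻¹) := by rw [inv_mul_inv]
      _ = (f * (t⁻¹ * t)) * t⁻¹ := by simp only [mul_assoc]
      _ = t⁻¹ * (t * f * t⁻¹) := by rw [idem_comm hf' (inv_mul_idem t)]; simp only [mul_assoc]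

end InverseMonoid

/-! ## Closed two-sided ideals of a C*-algebra -/

/-- A closed two-sided ideal of a C*-algebra `A`. -/
structure ClosedIdeal (A : Type*) [NonUnitalCStarAlgebra A] extends Submodule ℂ A where
  mul_mem_left' : ∀ (a : A) {x : A}, x ∈ carrier → a * x ∈ carrier
  mul_mem_right' : ∀ {x : A} (a : A), x ∈ carrier → x * a ∈ carrier
  isClosed' : IsClosed carrier

namespace ClosedIdeal

variable {A : Type*} [NonUnitalCStarAlgebra A]

instance : SetLike (ClosedIdeal A) A where
  coe I := I.carrier
  coe_injective I J h := by
    obtain ⟨⟨⟨⟨_, _⟩, _⟩, _⟩, _, _, _⟩ := I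
    obtain ⟨⟨⟨⟨_, _⟩, _⟩, _⟩, _, _, _⟩ := J
    congr

variable (I : ClosedIdeal A)

theorem zero_mem : (0 : A) ∈ I := I.zero_mem'
theorem add_mem {a b : A} (ha : a ∈ I) (hb : b ∈ I) : a + b ∈ I := I.add_mem' ha hb
theorem smul_mem (c : ℂ) {a : A} (ha : a ∈ I) : c • a ∈ I := I.smul_mem' c ha
theorem mul_mem_left (a : A) {x : A} (hx : x ∈ I) : a * x ∈ I := I.mul_mem_left' a hx
theorem mul_mem_right {x : A} (a : A) (hx : x ∈ I) : x * a ∈ I := I.mul_mem_right' a hx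
theorem isClosed : IsClosed (I : Set A) := I.isClosed'
theorem neg_mem {a : A} (ha : a ∈ I) : -a ∈ I := by
  have := I.smul_mem (-1) ha
  simpa using this
theorem sub_mem {a b : A} (ha : a ∈ I) (hb : b ∈ I) : a - b ∈ I := by
  rw [sub_eq_add_neg]; exact I.add_mem ha (I.neg_mem hb)

/-- A closed two-sided ideal of a C*-algebra is self-adjoint. -/
theorem star_mem {x : A} (hx : x ∈ I) : star x ∈ I := by
  let T : NonUnitalStarSubalgebra ℂ A :=
    { carrier := {y | y ∈ I ∧ star y ∈ I}
      zero_mem' := ⟨I.zero_mem, by simpa using I.zero_mem⟩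
      add_mem' := fun ha hb => ⟨I.add_mem ha.1 hb.1, by
        rw [star_add]; exact I.add_mem ha.2 hb.2⟩
      smul_mem' := fun c y hy => ⟨I.smul_mem c hy.1, by
        rw [star_smul]; exact I.smul_mem _ hy.2⟩
      mul_mem' := fun {a b} ha hb => ⟨I.mul_mem_left _ hb.1, by
        rw [star_mul]; exact I.mul_mem_left _ ha.2⟩
      star_mem' := fun ha => ⟨ha.2, by rw [star_star]; exact ha.1⟩ }
  have hTc : IsClosed (T : Set A) := I.isClosed.inter (I.isClosed.preimage continuous_star)
  set h : A := x * star x with hh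
  have hsa : IsSelfAdjoint h := .mul_star_self x
  have hhI : h ∈ T := ⟨I.mul_mem_right _ hx, by rw [hsa.star_eq]; exact I.mul_mem_right _ hx⟩
  let _ : PartialOrder A := CStarAlgebra.spectralOrder A
  have : StarOrderedRing A := CStarAlgebra.spectralOrderedRing A
  have hpos : 0 ≤ h := mul_star_self_nonneg x
  have key : ∀ n : ℕ, ∃ u ∈ I, ‖star x - star x * u‖ ^ 2 ≤ 1 / ((n : ℝ) + 1) := by
    intro n
    let g : ℝ → ℝ := fun t => ((n : ℝ) + 1) * |t| / (1 + ((n : ℝ) + 1) * |t|)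
    have hden : ∀ t : ℝ, 0 < 1 + ((n : ℝ) + 1) * |t| := fun t => by positivity
    have hg : Continuous g := by
      apply Continuous.div <;> first | fun_prop | exact fun t => (hden t).ne'
    have hg0 : g 0 = 0 := by simp [g]
    set u := cfcₙ g h with hu
    have huT : u ∈ T :=
      cfcₙ_mem (𝕜' := ℂ) (s := T) (hs := hTc) g hhI
    have hus : star u = u := (cfcₙ_predicate g h : IsSelfAdjoint u).star_eq
    refine ⟨u, huT.1, ?_⟩
    have e1 : ‖star x - star x * u‖ ^ 2 = ‖h - u * h - h * u + u * h * u‖ := by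
      rw [pow_two, ← CStarRing.norm_star_mul_self]
      congr 1
      simp only [star_sub, star_mul, star_star, hus, hh]
      noncomm_ring
    have e2 : h - u * h - h * u + u * h * u =
        cfcₙ (fun t : ℝ => t - g t * t - t * g t + g t * t * g t) h := by
      have c1 : ContinuousOn g (quasispectrum ℝ h) := hg.continuousOn
      rw [cfcₙ_add (fun t : ℝ => t - g t * t - t * g t) (fun t => g t * t * g t) h
        (by fun_prop) (by simp) (by fun_prop) (by simp),
        cfcₙ_sub (fun t : ℝ => t - g t * t) (fun t => t * g t) h
        (by fun_prop) (by simp) (by fun_prop) (by simp),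
        cfcₙ_sub (fun t : ℝ => t) (fun t => g t * t) h
        (by fun_prop) (by simp) (by fun_prop) (by simp),
        cfcₙ_mul (fun t : ℝ => g t * t) g h (by fun_prop) (by simp) (by fun_prop) hg0,
        cfcₙ_mul g (fun t : ℝ => t) h (by fun_prop) hg0 (by fun_prop) (by simp),
        cfcₙ_mul (fun t : ℝ => t) g h (by fun_prop) (by simp) (by fun_prop) hg0,
        cfcₙ_id' ℝ h hsa]
    rw [e1, e2]
    apply norm_cfcₙ_le
    intro t ht
    have ht0 : 0 ≤ t := quasispectrum_nonneg_of_nonneg h hpos t ht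
    have e3 : t - g t * t - t * g t + g t * t * g t = t / (1 + ((n : ℝ) + 1) * t) ^ 2 := by
      have := (hden t).ne'
      simp only [g, abs_of_nonneg ht0] at this ⊢
      field_simp
      ring
    rw [e3, Real.norm_of_nonneg (by positivity), div_le_div_iff₀ (by positivity) (by positivity)]
    nlinarith [mul_nonneg (by positivity : (0:ℝ) ≤ (n : ℝ) + 1) ht0,
      sq_nonneg (((n : ℝ) + 1) * t)]
  choose u hu hun using key
  have hlim : Filter.Tendsto (fun n => star x * u n) Filter.atTop (nhds (star x)) := by
    rw [tendsto_iff_norm_sub_tendsto_zero]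
    have h1 : Filter.Tendsto (fun n : ℕ => Real.sqrt (1 / ((n : ℝ) + 1))) Filter.atTop
        (nhds 0) := by
      simpa using (tendsto_one_div_add_atTop_nhds_zero_nat (𝕜 := ℝ)).sqrt
    refine squeeze_zero (fun n => norm_nonneg _) (fun n => ?_) h1
    rw [norm_sub_rev]
    exact Real.le_sqrt_of_sq_le (hun n)
  exact I.isClosed.mem_of_tendsto hlim (Filter.Eventually.of_forall fun n => I.mul_mem_left _ (hu n))

/-- A closed ideal, regarded as a (closed) *-subalgebra. -/
def toStarSubalgebra : NonUnitalStarSubalgebra ℂ A where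
  carrier := (I : Set A)
  zero_mem' := I.zero_mem
  add_mem' := I.add_mem
  smul_mem' c _ := I.smul_mem c
  mul_mem' {a _} _ hb := I.mul_mem_left a hb
  star_mem' := I.star_mem

end ClosedIdeal

/-! ## C*-seminorms, completions, and enveloping C*-algebras -/

/-- A C*-seminorm on a complex *-algebra. -/
structure CStarSeminorm (B : Type*) [NonUnitalRing B] [StarRing B] [Module ℂ B] extends
    Seminorm ℂ B where
  mul_le' : ∀ x y, toFun (x * y) ≤ toFun x * toFun y
  star_mul_self' : ∀ x, toFun (star x * x) = toFun x * toFun x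

namespace CStarSeminorm

variable {B : Type*} [NonUnitalRing B] [StarRing B] [Module ℂ B]

instance : CoeFun (CStarSeminorm B) (fun _ => B → ℝ) := ⟨fun p => p.toFun⟩

variable (p : CStarSeminorm B)

theorem star_eq (x : B) : p (star x) = p x := by
  have h0 : ∀ y, 0 ≤ p y := fun y => apply_nonneg p.toSeminorm y
  have key : ∀ y, p y ≤ p (star y) := by
    intro y
    rcases (h0 y).eq_or_lt with h | h
    · rw [← h]; exact h0 _
    · have h1 : p y * p y ≤ p (star y) * p y := by
        rw [← p.star_mul_self']; exact p.mul_le' _ _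
      exact le_of_mul_le_mul_right h1 h
  refine le_antisymm ?_ (key x)
  simpa using key (star x)

/-- The *-algebra `B`, regarded as a seminormed space through `p`. -/
def Carrier (_p : CStarSeminorm B) : Type _ := B

instance : NonUnitalRing p.Carrier := inferInstanceAs (NonUnitalRing B)
instance : StarRing p.Carrier := inferInstanceAs (StarRing B)
instance : Module ℂ p.Carrier := inferInstanceAs (Module ℂ B)

instance : SeminormedAddCommGroup p.Carrier :=
  { p.toSeminorm.toAddGroupSeminorm.toSeminormedAddCommGroup with
    toAddCommGroup := inferInstanceAs (AddCommGroup p.Carrier) }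

theorem norm_carrier (x : p.Carrier) : ‖x‖ = p (x : B) := rfl

instance : NonUnitalSeminormedRing p.Carrier :=
  { (inferInstance : NonUnitalRing p.Carrier), (inferInstance : SeminormedAddCommGroup p.Carrier) with
    norm_mul_le := p.mul_le' }

instance : NormedSpace ℂ p.Carrier where
  norm_smul_le c x := (map_smul_eq_mul p.toSeminorm c x).le

instance : NormedStarGroup p.Carrier where
  norm_star_le x := (p.star_eq x).le

instance [h : IsScalarTower ℂ B B] : IsScalarTower ℂ p.Carrier p.Carrier := h
instance [h : SMulCommClass ℂ B B] : SMulCommClass ℂ p.Carrier p.Carrier := h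
instance [h : StarModule ℂ B] : StarModule ℂ p.Carrier := h

/-- The Hausdorff completion of the *-algebra `B` with respect to the C*-seminorm `p`, that is, the
completion of `B ⧸ {x | p x = 0}` with respect to the norm induced by `p`. -/
def Completion : Type _ := UniformSpace.Completion p.Carrier

open UniformSpace

instance : NormedAddCommGroup p.Completion :=
  inferInstanceAs (NormedAddCommGroup (UniformSpace.Completion p.Carrier))
instance : NormedSpace ℂ p.Completion :=
  inferInstanceAs (NormedSpace ℂ (UniformSpace.Completion p.Carrier))
instance : CompleteSpace p.Completion :=
  inferInstanceAs (CompleteSpace (UniformSpace.Completion p.Carrier))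

/-- The canonical map from `B` to its completion. -/
def ofB (x : B) : p.Completion := ((show p.Carrier from x : p.Carrier) : UniformSpace.Completion p.Carrier)

theorem norm_ofB (x : B) : ‖p.ofB x‖ = p x := Completion.norm_coe (E := p.Carrier) x

theorem ofB_add (x y : B) : p.ofB (x + y) = p.ofB x + p.ofB y :=
  Completion.coe_add (α := p.Carrier) x y
theorem ofB_zero : p.ofB 0 = 0 := Completion.coe_zero (α := p.Carrier)
theorem ofB_smul (c : ℂ) (x : B) : p.ofB (c • x) = c • p.ofB x :=
  Completion.coe_smul (X := p.Carrier) c x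

theorem denseRange_ofB : DenseRange p.ofB := Completion.denseRange_coe (α := p.Carrier)

theorem ind {P : p.Completion → Prop} (hc : IsClosed {x | P x}) (h : ∀ b, P (p.ofB b)) :
    ∀ x, P x := fun x => Completion.induction_on (α := p.Carrier) x hc h

/-- The multiplication of the completion is the continuous extension of that of `B`. -/
instance : Mul p.Completion :=
  ⟨Function.curry <| ((Completion.isDenseInducing_coe (α := p.Carrier)).prodMap
    (Completion.isDenseInducing_coe (α := p.Carrier))).extend
      (fun q : p.Carrier × p.Carrier => p.ofB (q.1 * q.2))⟩

theorem ofB_mul (x y : B) : p.ofB (x * y) = p.ofB x * p.ofB y :=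
  (((Completion.isDenseInducing_coe (α := p.Carrier)).prodMap
    (Completion.isDenseInducing_coe (α := p.Carrier))).extend_eq
      ((Completion.continuous_coe p.Carrier).comp (continuous_mul (M := p.Carrier)))
      ((x : p.Carrier), (y : p.Carrier))).symm

instance : ContinuousMul p.Completion where
  continuous_mul := by
    let m := (AddMonoidHom.mul : p.Carrier →+ p.Carrier →+ p.Carrier).compr₂
      (Completion.toCompl (α := p.Carrier))
    have : Continuous fun q : p.Carrier × p.Carrier => m q.1 q.2 :=
      (Completion.continuous_coe p.Carrier).comp continuous_mul
    have di : IsDenseInducing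
        (Completion.toCompl : p.Carrier → UniformSpace.Completion p.Carrier) :=
      Completion.isDenseInducing_coe
    exact (di.extend_Z_bilin di this :)

/-- The involution of the completion is the continuous extension of that of `B`. -/
instance : Star p.Completion :=
  ⟨Completion.map (α := p.Carrier) (β := p.Carrier) star⟩

theorem uniformContinuous_star_carrier : UniformContinuous (star : p.Carrier → p.Carrier) :=
  uniformContinuous_addMonoidHom_of_continuous
    (f := (starAddEquiv : p.Carrier ≃+ p.Carrier).toAddMonoidHom) continuous_star

theorem ofB_star (x : B) : p.ofB (star x) = star (p.ofB x) :=
  (Completion.map_coe (p.uniformContinuous_star_carrier) x).symm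

instance : ContinuousStar p.Completion where
  continuous_star := Completion.continuous_map (α := p.Carrier) (β := p.Carrier)

theorem ind₂ {P : p.Completion → p.Completion → Prop} (hc : IsClosed {x : _ × _ | P x.1 x.2})
    (h : ∀ b c, P (p.ofB b) (p.ofB c)) : ∀ x y, P x y := fun x y =>
  Completion.induction_on₂ (α := p.Carrier) (β := p.Carrier) x y hc h

theorem ind₃ {P : p.Completion → p.Completion → p.Completion → Prop}
    (hc : IsClosed {x : _ × _ × _ | P x.1 x.2.1 x.2.2})
    (h : ∀ b c d, P (p.ofB b) (p.ofB c) (p.ofB d)) : ∀ x y z, P x y z := fun x y z =>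
  Completion.induction_on₃ (α := p.Carrier) (β := p.Carrier) (γ := p.Carrier) x y z hc h

instance : NonUnitalRing p.Completion :=
  { (inferInstance : AddCommGroup p.Completion), (inferInstance : Mul p.Completion) with
    zero_mul := p.ind (isClosed_eq (by fun_prop) continuous_const)
      fun a => by rw [← ofB_zero, ← ofB_mul, zero_mul]
    mul_zero := p.ind (isClosed_eq (by fun_prop) continuous_const)
      fun a => by rw [← ofB_zero, ← ofB_mul, mul_zero]
    mul_assoc := p.ind₃ (isClosed_eq (by fun_prop) (by fun_prop))
      fun a b c => by simp only [← ofB_mul, mul_assoc]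
    left_distrib := p.ind₃ (isClosed_eq (by fun_prop) (by fun_prop))
      fun a b c => by simp only [← ofB_mul, ← ofB_add, mul_add]
    right_distrib := p.ind₃ (isClosed_eq (by fun_prop) (by fun_prop))
      fun a b c => by simp only [← ofB_mul, ← ofB_add, add_mul] }

instance : NonUnitalNormedRing p.Completion :=
  { (inferInstance : NormedAddCommGroup p.Completion),
    (inferInstance : NonUnitalRing p.Completion) with
    norm_mul_le := p.ind₂ (isClosed_le (by fun_prop) (by fun_prop))
      fun a b => by rw [← ofB_mul, norm_ofB, norm_ofB, norm_ofB]; exact p.mul_le' a b }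

instance : StarRing p.Completion where
  star_involutive := p.ind (isClosed_eq (by fun_prop) (by fun_prop))
    fun a => by rw [← ofB_star, ← ofB_star, star_star]
  star_mul := p.ind₂ (isClosed_eq (by fun_prop) (by fun_prop))
    fun a b => by simp only [← ofB_star, ← ofB_mul, star_mul]
  star_add := p.ind₂ (isClosed_eq (by fun_prop) (by fun_prop))
    fun a b => by simp only [← ofB_star, ← ofB_add, star_add]

theorem completion_smul_mul [IsScalarTower ℂ B B] (c : ℂ) : ∀ x y : p.Completion, (c • x) * y = c • (x * y) :=
  p.ind₂ (isClosed_eq ((continuous_fst.const_smul c).mul continuous_snd)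
      ((continuous_fst.mul continuous_snd).const_smul c))
    fun a b => by rw [← ofB_smul, ← ofB_mul, smul_mul_assoc, ofB_smul, ofB_mul]

theorem completion_mul_smul [SMulCommClass ℂ B B] (c : ℂ) : ∀ x y : p.Completion, x * (c • y) = c • (x * y) :=
  p.ind₂ (isClosed_eq (continuous_fst.mul (continuous_snd.const_smul c))
      ((continuous_fst.mul continuous_snd).const_smul c))
    fun a b => by rw [← ofB_smul, ← ofB_mul, mul_smul_comm, ofB_smul, ofB_mul]

theorem completion_star_smul [StarModule ℂ B] (c : ℂ) : ∀ x : p.Completion, star (c • x) = star c • star x :=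
  p.ind (isClosed_eq ((continuous_id.const_smul c).star) (continuous_star.const_smul (star c)))
    fun a => by rw [← ofB_smul, ← ofB_star, star_smul, ofB_smul, ofB_star]

theorem completion_norm_mul_self_le :
    ∀ x : p.Completion, ‖x‖ * ‖x‖ ≤ ‖star x * x‖ :=
  p.ind (isClosed_le (by fun_prop) (by fun_prop))
    fun a => by
      rw [← ofB_star, ← ofB_mul, norm_ofB, norm_ofB]; exact (p.star_mul_self' a).ge

instance [IsScalarTower ℂ B B] [SMulCommClass ℂ B B] [StarModule ℂ B] :
    NonUnitalCStarAlgebra p.Completion where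
  norm_mul_self_le := p.completion_norm_mul_self_le
  smul_assoc := p.completion_smul_mul
  smul_comm c x y := (p.completion_mul_smul c x y).symm
  star_smul := p.completion_star_smul

/-- The canonical *-homomorphism from `B` to its completion. -/
def toCompletion : B →⋆ₙₐ[ℂ] p.Completion where
  toFun := p.ofB
  map_smul' := p.ofB_smul
  map_zero' := p.ofB_zero
  map_add' := p.ofB_add
  map_mul' := p.ofB_mul
  map_star' := p.ofB_star

end CStarSeminorm

/-- A representation of a *-algebra `B`: a Hilbert space `H` with a *-homomorphism
`B → B(H)`. -/
structure StarRep.{w, u} (B : Type u) [NonUnitalRing B] [StarRing B] [Module ℂ B] where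
  H : Type w
  [normedAddCommGroup : NormedAddCommGroup H]
  [innerProductSpace : InnerProductSpace ℂ H]
  [completeSpace : CompleteSpace H]
  hom : B →⋆ₙₐ[ℂ] (H →L[ℂ] H)

attribute [instance] StarRep.normedAddCommGroup StarRep.innerProductSpace StarRep.completeSpace

namespace StarRep

variable {B : Type*} [NonUnitalRing B] [StarRing B] [Module ℂ B]

instance : Inhabited (StarRep B) := ⟨{ H := PUnit, hom := 0 }⟩

/-- The C*-seminorm `x ↦ sup_i ‖ρ_i x‖` of a pointwise bounded family of representations. -/
def supSeminorm {ι : Type*} [Nonempty ι] (ρ : ι → StarRep B)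
    (hb : ∀ x, BddAbove (Set.range fun i => ‖(ρ i).hom x‖)) : CStarSeminorm B where
  toFun x := ⨆ i, ‖(ρ i).hom x‖
  map_zero' := by simp
  add_le' x y := ciSup_le fun i => by
    rw [map_add]
    exact (norm_add_le _ _).trans (add_le_add (le_ciSup (hb x) i) (le_ciSup (hb y) i))
  neg' x := by simp
  smul' c x := by
    simp only [map_smul, norm_smul]
    exact (Real.mul_iSup_of_nonneg (norm_nonneg c) _).symm
  mul_le' x y := ciSup_le fun i => by
    rw [map_mul]
    exact (norm_mul_le _ _).trans (mul_le_mul (le_ciSup (hb x) i) (le_ciSup (hb y) i)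
      (norm_nonneg _) (Real.iSup_nonneg fun i => norm_nonneg _))
  star_mul_self' x := by
    have h0 : 0 ≤ ⨆ i, ‖(ρ i).hom x‖ := Real.iSup_nonneg fun i => norm_nonneg _
    apply le_antisymm
    · refine ciSup_le fun i => ?_
      rw [map_mul, map_star, CStarRing.norm_star_mul_self]
      exact mul_le_mul (le_ciSup (hb x) i) (le_ciSup (hb x) i) (norm_nonneg _) h0
    · have h1 : ⨆ i, ‖(ρ i).hom x‖ ≤ Real.sqrt (⨆ i, ‖(ρ i).hom (star x * x)‖) := by
        refine ciSup_le fun i => Real.le_sqrt_of_sq_le ?_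
        refine le_trans (le_of_eq ?_) (le_ciSup (hb (star x * x)) i)
        rw [map_mul, map_star, CStarRing.norm_star_mul_self, pow_two]
      calc _ ≤ _ := mul_self_le_mul_self h0 h1
        _ = _ := Real.mul_self_sqrt (Real.iSup_nonneg fun i => norm_nonneg _)

end StarRep

/-- The universal seminorm `ρ_s(x) = sup {‖ρ(x)‖ : ρ a representation of B}` of a *-algebra all of
whose representations are bounded, pointwise and uniformly. The Hilbert spaces range over the
universe of `B`; the essential part of any representation is a direct sum of cyclic ones, whose
Hilbert spaces are completions of quotients of `B`, so that this is the supremum over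
all representations. -/
def envelopingSeminorm.{u} (B : Type u) [NonUnitalRing B] [StarRing B] [Module ℂ B]
    (hb : ∀ x : B, BddAbove (Set.range fun ρ : StarRep.{u} B => ‖ρ.hom x‖)) : CStarSeminorm B :=
  StarRep.supSeminorm (fun ρ : StarRep.{u} B => ρ) hb

/-- The enveloping C*-algebra of `B`: the completion of `B ⧸ ker ρ_s` with respect to the universal
seminorm `ρ_s`. -/
abbrev EnvelopingCStarAlgebra.{u} (B : Type u) [NonUnitalRing B] [StarRing B] [Module ℂ B]
    (hb : ∀ x : B, BddAbove (Set.range fun ρ : StarRep.{u} B => ‖ρ.hom x‖)) : Type u :=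
  (envelopingSeminorm B hb).Completion

/-! ## Actions of unital inverse semigroups on C*-algebras -/

/-- An action of the unital inverse semigroup `S` on the C*-algebra `A`: closed two-sided ideals
`E s` and *-isomorphisms `β_s : E s⁻¹ → E s` with `β_r ∘ β_s = β_{rs}` as partially defined maps
(equality of domains and of values), and `E 1 = A`. The map `β_s` is given by `act s`, whose values
outside `E s⁻¹` are irrelevant and are used nowhere. -/
structure CStarAction (S A : Type*) [InverseMonoid S] [NonUnitalCStarAlgebra A] where
  E : S → ClosedIdeal A
  act : S → A → A
  bijOn : ∀ s, Set.BijOn (act s) (E s⁻¹ : Set A) (E s : Set A)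
  map_add : ∀ s, ∀ a ∈ E s⁻¹, ∀ b ∈ E s⁻¹, act s (a + b) = act s a + act s b
  map_smul : ∀ s (c : ℂ), ∀ a ∈ E s⁻¹, act s (c • a) = c • act s a
  map_mul : ∀ s, ∀ a ∈ E s⁻¹, ∀ b ∈ E s⁻¹, act s (a * b) = act s a * act s b
  map_star : ∀ s, ∀ a ∈ E s⁻¹, act s (star a) = star (act s a)
  comp_domain : ∀ r s a, a ∈ E (r * s)⁻¹ ↔ a ∈ E s⁻¹ ∧ act s a ∈ E r⁻¹
  comp_apply : ∀ r s, ∀ a ∈ E (r * s)⁻¹, act (r * s) a = act r (act s a)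
  E_one : ∀ a, a ∈ E 1

namespace CStarAction

open InverseMonoid

variable {S A : Type*} [InverseMonoid S] [NonUnitalCStarAlgebra A] (β : CStarAction S A)

theorem act_mem {s : S} {a : A} (ha : a ∈ β.E s⁻¹) : β.act s a ∈ β.E s := (β.bijOn s).mapsTo ha

theorem act_inv_mem {s : S} {a : A} (ha : a ∈ β.E s) : β.act s⁻¹ a ∈ β.E s⁻¹ :=
  β.act_mem (by rwa [inv_inv'])

theorem act_idem {f : S} (hf : f * f = f) {a : A} (ha : a ∈ β.E f) : β.act f a = a := by
  have hi := inv_of_idem hf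
  have ha' : a ∈ β.E f⁻¹ := by rwa [hi]
  have h1 : β.act f (β.act f a) = β.act f a := by
    have := β.comp_apply f f a (by rwa [hf])
    rw [hf] at this; exact this.symm
  have hm : β.act f a ∈ β.E f⁻¹ := by rw [hi]; exact β.act_mem ha'
  exact (β.bijOn f).injOn hm ha' h1

theorem mem_mul_inv_self {s : S} {a : A} (ha : a ∈ β.E s) : a ∈ β.E (s * s⁻¹) := by
  obtain ⟨b, hb, rfl⟩ := (β.bijOn s).surjOn ha
  have hc : β.act s b ∈ β.E s⁻¹⁻¹ := by rw [inv_inv']; exact ha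
  have h3 : β.act s b ∈ β.E (s * s⁻¹)⁻¹ := by
    rw [β.comp_domain]
    exact ⟨hc, β.act_mem hc⟩
  rwa [inv_of_idem (mul_inv_idem s)] at h3

theorem act_act_inv {s : S} {a : A} (ha : a ∈ β.E s) : β.act s (β.act s⁻¹ a) = a := by
  have h := β.mem_mul_inv_self ha
  have h' : a ∈ β.E (s * s⁻¹)⁻¹ := by rwa [inv_of_idem (mul_inv_idem s)]
  rw [← β.comp_apply s s⁻¹ a h', β.act_idem (mul_inv_idem s) h]

theorem act_inv_act {s : S} {a : A} (ha : a ∈ β.E s⁻¹) : β.act s⁻¹ (β.act s a) = a := by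
  have := β.act_act_inv ha
  rwa [inv_inv'] at this

theorem mem_of_mem_mul {s t : S} {a : A} (ha : a ∈ β.E (s * t)) : a ∈ β.E s := by
  have h : a ∈ β.E (t⁻¹ * s⁻¹)⁻¹ := by rwa [mul_inv_rev', inv_inv', inv_inv']
  have := ((β.comp_domain _ _ _).1 h).1
  rwa [inv_inv'] at this

theorem act_mul_mem {s t : S} {a : A} (ha : a ∈ β.E s⁻¹) (ha' : a ∈ β.E t) :
    β.act s a ∈ β.E (s * t) := by
  have h : β.act s a ∈ β.E (t⁻¹ * s⁻¹)⁻¹ := by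
    rw [β.comp_domain, inv_inv', inv_inv', β.act_inv_act ha]
    exact ⟨β.act_mem ha, ha'⟩
  rwa [mul_inv_rev', inv_inv', inv_inv'] at h

theorem mem_of_natLE {r t : S} (h : NatLE r t) {a : A} (ha : a ∈ β.E r) : a ∈ β.E t := by
  obtain ⟨f, _, rfl⟩ := h
  exact β.mem_of_mem_mul ha

theorem act_inv_natLE {r t : S} (h : NatLE r t) {a : A} (ha : a ∈ β.E r) :
    β.act r⁻¹ a = β.act t⁻¹ a := by
  obtain ⟨f, hf, rfl⟩ := h
  have hf' : f * f = f := hf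
  have e : (t * f)⁻¹ = f * t⁻¹ := by rw [mul_inv_rev', inv_of_idem hf']
  have ha' : a ∈ β.E (f * t⁻¹)⁻¹ := by rwa [← e, inv_inv']
  rw [e, β.comp_apply f t⁻¹ a ha']
  refine β.act_idem hf' ?_
  have := ((β.comp_domain _ _ _).1 ha').2
  rwa [inv_of_idem hf'] at this

/-- `β_s` as a *-homomorphism between the C*-algebras `E s⁻¹` and `E s`. -/
def actHom (s : S) : (β.E s⁻¹).toStarSubalgebra →⋆ₙₐ[ℂ] (β.E s).toStarSubalgebra where
  toFun a := ⟨β.act s a, β.act_mem a.2⟩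
  map_smul' c a := Subtype.ext (β.map_smul s c a a.2)
  map_zero' := Subtype.ext (by
    have := β.map_smul s 0 0 (ClosedIdeal.zero_mem _)
    simpa using this)
  map_add' a b := Subtype.ext (β.map_add s a a.2 b b.2)
  map_mul' a b := Subtype.ext (β.map_mul s a a.2 b b.2)
  map_star' a := Subtype.ext (β.map_star s a a.2)

theorem act_zero (s : S) : β.act s 0 = 0 := by
  have := β.map_smul s 0 0 (ClosedIdeal.zero_mem _)
  simpa using this

theorem norm_act_le {s : S} {a : A} (ha : a ∈ β.E s⁻¹) : ‖β.act s a‖ ≤ ‖a‖ := by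
  have h1 : IsClosed ((β.E s⁻¹).toStarSubalgebra : Set A) := (β.E s⁻¹).isClosed
  have h2 : IsClosed ((β.E s).toStarSubalgebra : Set A) := (β.E s).isClosed
  let i1 : NonUnitalCStarAlgebra (β.E s⁻¹).toStarSubalgebra :=
    NonUnitalStarSubalgebra.nonUnitalCStarAlgebra _ (h_closed := h1)
  let i2 : NonUnitalCStarAlgebra (β.E s).toStarSubalgebra :=
    NonUnitalStarSubalgebra.nonUnitalCStarAlgebra _ (h_closed := h2)
  exact NonUnitalStarAlgHom.norm_apply_le (β.actHom s) ⟨a, ha⟩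

/-- The coefficient `β_r(β_{r⁻¹}(a) b)` of the product `(a δ_r)(b δ_t)`. -/
def coeff (r : S) (a b : A) : A := β.act r (β.act r⁻¹ a * b)

theorem coeff_mem {r t : S} {a b : A} (ha : a ∈ β.E r) (hb : b ∈ β.E t) :
    β.coeff r a b ∈ β.E (r * t) :=
  β.act_mul_mem ((β.E _).mul_mem_right _ (β.act_inv_mem ha)) ((β.E _).mul_mem_left _ hb)

theorem inv_inv_mem {r : S} {a : A} (ha : a ∈ β.E r) : a ∈ β.E r⁻¹⁻¹ := by rwa [inv_inv']

theorem norm_coeff_le {r : S} {a : A} (ha : a ∈ β.E r) (b : A) :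
    ‖β.coeff r a b‖ ≤ ‖a‖ * ‖b‖ :=
  (β.norm_act_le ((β.E _).mul_mem_right _ (β.act_inv_mem ha))).trans
    ((norm_mul_le _ _).trans
      (mul_le_mul_of_nonneg_right (β.norm_act_le (β.inv_inv_mem ha)) (norm_nonneg _)))

theorem coeff_add_left {r : S} {a a' : A} (ha : a ∈ β.E r) (ha' : a' ∈ β.E r) (b : A) :
    β.coeff r (a + a') b = β.coeff r a b + β.coeff r a' b := by
  unfold coeff
  rw [β.map_add _ _ (β.inv_inv_mem ha) _ (β.inv_inv_mem ha'), add_mul,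
    β.map_add _ _ ((β.E _).mul_mem_right _ (β.act_inv_mem ha)) _
      ((β.E _).mul_mem_right _ (β.act_inv_mem ha'))]

theorem coeff_add_right {r : S} {a : A} (ha : a ∈ β.E r) (b b' : A) :
    β.coeff r a (b + b') = β.coeff r a b + β.coeff r a b' := by
  unfold coeff
  rw [mul_add, β.map_add _ _ ((β.E _).mul_mem_right _ (β.act_inv_mem ha)) _
      ((β.E _).mul_mem_right _ (β.act_inv_mem ha))]

theorem coeff_smul_left {r : S} (c : ℂ) {a : A} (ha : a ∈ β.E r) (b : A) :
    β.coeff r (c • a) b = c • β.coeff r a b := by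
  unfold coeff
  rw [β.map_smul _ _ _ (β.inv_inv_mem ha), smul_mul_assoc,
    β.map_smul _ _ _ ((β.E _).mul_mem_right _ (β.act_inv_mem ha))]

theorem coeff_smul_right {r : S} (c : ℂ) {a : A} (ha : a ∈ β.E r) (b : A) :
    β.coeff r a (c • b) = c • β.coeff r a b := by
  unfold coeff
  rw [mul_smul_comm, β.map_smul _ _ _ ((β.E _).mul_mem_right _ (β.act_inv_mem ha))]

theorem coeff_zero_left (r : S) (b : A) : β.coeff r 0 b = 0 := by
  simp [coeff, act_zero]

theorem coeff_zero_right (r : S) (a : A) : β.coeff r a 0 = 0 := by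
  simp [coeff, act_zero]

/-- Left multiplication by `a` commutes with `c ↦ β_s(β_{s⁻¹}(c) b)` on the ideal `E s`. -/
theorem coeff_mul_left {s : S} (a : A) {c : A} (hc : c ∈ β.E s) (b : A) :
    β.coeff s (a * c) b = a * β.coeff s c b := by
  have hmul : ∀ d ∈ β.E s, ∀ c ∈ β.E s, β.coeff s (d * c) b = d * β.coeff s c b := by
    intro d hd c hc
    unfold coeff
    rw [β.map_mul _ _ (β.inv_inv_mem hd) _ (β.inv_inv_mem hc), mul_assoc,
      β.map_mul _ _ (β.act_inv_mem hd) _ ((β.E _).mul_mem_right _ (β.act_inv_mem hc)),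
      β.act_act_inv hd]
  have hcm : ∀ c ∈ β.E s, β.coeff s c b ∈ β.E s := fun c hc =>
    β.act_mem ((β.E _).mul_mem_right _ (β.act_inv_mem hc))
  set z := β.coeff s (a * c) b - a * β.coeff s c b with hz
  have hzE : z ∈ β.E s := (β.E s).sub_mem (hcm _ ((β.E s).mul_mem_left _ hc))
    ((β.E s).mul_mem_left _ (hcm _ hc))
  have h0 : ∀ d ∈ β.E s, d * z = 0 := by
    intro d hd
    rw [hz, mul_sub, ← hmul d hd _ ((β.E s).mul_mem_left _ hc), ← mul_assoc, ← mul_assoc,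
      ← hmul _ ((β.E s).mul_mem_right _ hd) c hc, sub_self]
  have := h0 _ ((β.E s).star_mem hzE)
  rw [CStarRing.star_mul_self_eq_zero_iff] at this
  exact sub_eq_zero.1 this

theorem coeff_assoc {r s : S} {a b : A} (ha : a ∈ β.E r) (hb : b ∈ β.E s) (c : A) :
    β.coeff (r * s) (β.coeff r a b) c = β.coeff r a (β.coeff s b c) := by
  have hab := β.coeff_mem ha hb
  set d := β.act r⁻¹ a with hd
  have hdr : d ∈ β.E r⁻¹ := β.act_inv_mem ha
  have hdb : d * b ∈ β.E r⁻¹ := (β.E _).mul_mem_right _ hdr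
  have hdb' : d * b ∈ β.E s := (β.E _).mul_mem_left _ hb
  have e0 : β.coeff r a b = β.act r (d * b) := rfl
  have e1 : β.act (r * s)⁻¹ (β.coeff r a b) = β.act s⁻¹ (d * b) := by
    have hm := hab
    rw [mul_inv_rev', β.comp_apply s⁻¹ r⁻¹ _ (by rw [← mul_inv_rev', inv_inv']; exact hm), e0,
      β.act_inv_act hdb]
  have e2 : β.act (r * s)⁻¹ (β.coeff r a b) ∈ β.E (r * s)⁻¹ := β.act_inv_mem hab
  rw [show β.coeff (r * s) (β.coeff r a b) c
      = β.act (r * s) (β.act (r * s)⁻¹ (β.coeff r a b) * c) from rfl,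
    β.comp_apply r s _ ((β.E _).mul_mem_right _ e2), e1,
    show β.act s (β.act s⁻¹ (d * b) * c) = β.coeff s (d * b) c from rfl,
    β.coeff_mul_left d hb c]
  rfl

theorem star_coeff {r s : S} {a b : A} (ha : a ∈ β.E r) (hb : b ∈ β.E s) :
    β.act (r * s)⁻¹ (star (β.coeff r a b)) =
      β.coeff s⁻¹ (β.act s⁻¹ (star b)) (β.act r⁻¹ (star a)) := by
  have hd : β.act r⁻¹ a ∈ β.E r⁻¹ := β.act_inv_mem ha
  have hdb : β.act r⁻¹ a * b ∈ β.E r⁻¹ := (β.E _).mul_mem_right _ hd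
  have hs := (β.E _).star_mem (β.coeff_mem ha hb)
  rw [mul_inv_rev', β.comp_apply s⁻¹ r⁻¹ _ (by rw [← mul_inv_rev', inv_inv']; exact hs)]
  unfold coeff
  rw [inv_inv', β.act_act_inv ((β.E _).star_mem hb), β.map_star _ _ (β.inv_inv_mem ha),
    β.map_star _ _ (β.inv_inv_mem (β.act_mem hdb)), β.act_inv_act hdb, star_mul]

end CStarAction

/-! ## The ℓ¹-algebra of an action -/

namespace CStarAction

open InverseMonoid

variable {S A : Type*} [InverseMonoid S] [NonUnitalCStarAlgebra A] (β : CStarAction S A)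

/-- The space `L̃ = {x ∈ ℓ¹(S, A) : x(s) ∈ E s}` with the norm and the linear structure of
`ℓ¹(S, A)`. -/
def ellOne : Submodule ℂ (lp (fun _ : S => A) 1) where
  carrier := {x | ∀ s, (x : S → A) s ∈ β.E s}
  zero_mem' s := (β.E s).zero_mem
  add_mem' hx hy s := (β.E s).add_mem (hx s) (hy s)
  smul_mem' c _ hx s := (β.E s).smul_mem c (hx s)

/-- The type of elements of `L̃`. -/
def EllOne : Type _ := β.ellOne

instance : NormedAddCommGroup β.EllOne := inferInstanceAs (NormedAddCommGroup β.ellOne)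
instance : NormedSpace ℂ β.EllOne := inferInstanceAs (NormedSpace ℂ β.ellOne)

namespace EllOne

variable {β}

instance : CoeFun β.EllOne (fun _ => S → A) := ⟨fun x => ((x.1 : lp (fun _ : S => A) 1) : S → A)⟩

theorem mem (x : β.EllOne) (s : S) : x s ∈ β.E s := x.2 s

@[ext] theorem ext {x y : β.EllOne} (h : ∀ s, x s = y s) : x = y :=
  Subtype.ext (lp.ext (funext h))

theorem add_apply (x y : β.EllOne) (s : S) : (x + y) s = x s + y s := rfl
theorem smul_apply (c : ℂ) (x : β.EllOne) (s : S) : (c • x) s = c • x s := rfl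
theorem zero_apply (s : S) : (0 : β.EllOne) s = 0 := rfl

theorem summable_norm (x : β.EllOne) : Summable fun s => ‖x s‖ := by
  have := (lp.memℓp x.1).summable (by simp)
  simpa using this

theorem norm_def (x : β.EllOne) : ‖x‖ = ∑' s, ‖x s‖ := by
  have := lp.norm_eq_tsum_rpow (p := 1) (by simp) x.1
  simp only [ENNReal.toReal_one, Real.rpow_one, div_one] at this
  exact this

/-- The element of `L̃` with the given absolutely summable coordinates. -/
def mk (f : S → A) (hf : Summable fun s => ‖f s‖) (hE : ∀ s, f s ∈ β.E s) : β.EllOne :=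
  ⟨⟨f, memℓp_gen (by simpa using hf)⟩, hE⟩

theorem mk_apply (f : S → A) (hf : Summable fun s => ‖f s‖) (hE : ∀ s, f s ∈ β.E s) (s : S) :
    mk (β := β) f hf hE s = f s := rfl

open scoped Classical in
/-- The element `a δ_s`. -/
def delta (s : S) (a : β.E s) : β.EllOne :=
  ⟨lp.single 1 s (a : A), fun t => by
    rcases eq_or_ne t s with rfl | h
    · rw [lp.single_apply_self]; exact a.2
    · rw [lp.single_apply_ne _ _ _ h]; exact (β.E t).zero_mem⟩

theorem delta_self (s : S) (a : β.E s) : delta s a s = a := by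
  classical exact lp.single_apply_self ..

theorem delta_ne {s t : S} (a : β.E s) (h : t ≠ s) : delta s a t = 0 := by
  classical exact lp.single_apply_ne _ _ _ h

theorem delta_add (s : S) (a b : β.E s) (h : (a : A) + (b : A) ∈ β.E s) :
    delta s ⟨(a : A) + (b : A), h⟩ = delta s a + delta s b := by
  ext t
  rw [add_apply]
  rcases eq_or_ne t s with rfl | h
  · rw [delta_self, delta_self, delta_self]
  · rw [delta_ne _ h, delta_ne _ h, delta_ne _ h, add_zero]

theorem delta_smul (s : S) (c : ℂ) (a : β.E s) (h : c • (a : A) ∈ β.E s) :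
    delta s ⟨c • (a : A), h⟩ = c • delta s a := by
  ext t
  rw [smul_apply]
  rcases eq_or_ne t s with rfl | h
  · rw [delta_self, delta_self]
  · rw [delta_ne _ h, delta_ne _ h, smul_zero]

theorem norm_delta (s : S) (a : β.E s) : ‖delta s a‖ = ‖(a : A)‖ := by
  classical
  have := lp.norm_single (E := fun _ : S => A) (p := 1) (by simp) s (a : A)
  rw [← this]
  change ‖lp.single (E := fun _ : S => A) 1 s (a : A)‖ = _
  congr!

theorem delta_congr {s t : S} (h : s = t) (a : A) (hs : a ∈ β.E s) (ht : a ∈ β.E t) :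
    delta s ⟨a, hs⟩ = delta t ⟨a, ht⟩ := by subst h; rfl

theorem hasSum_delta (x : β.EllOne) : HasSum (fun s => delta s ⟨x s, x.mem s⟩) x := by
  classical
  have h := lp.hasSum_single (E := fun _ : S => A) (p := 1) (by simp) x.1
  rw [show HasSum (fun s => delta s ⟨x s, x.mem s⟩) x ↔
    HasSum ((β.ellOne.subtypeL) ∘ (fun s => (delta s ⟨x s, x.mem s⟩ : β.ellOne))) x.1 from
      (Topology.IsInducing.subtypeVal.hasSum_iff
        (f := fun s => (delta s ⟨x s, x.mem s⟩ : β.ellOne)) (g := β.ellOne.subtype) x).symm]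
  convert h using 1
  funext s
  simp only [Function.comp, delta]
  change lp.single (E := fun _ : S => A) 1 s (x s) = _
  congr!

/-- Continuous additive maps on `L̃` are determined by their values on the `a δ_s`. -/
theorem addHom_ext {M : Type*} [AddCommGroup M] [TopologicalSpace M] [T2Space M]
    {f g : β.EllOne →+ M} (hf : Continuous f) (hg : Continuous g)
    (h : ∀ s a, f (delta s a) = g (delta s a)) (x : β.EllOne) : f x = g x := by
  have h1 := (hasSum_delta x).map f hf
  have h2 := (hasSum_delta x).map g hg
  have e : f ∘ (fun s => delta s ⟨x s, x.mem s⟩) = g ∘ fun s => delta s ⟨x s, x.mem s⟩ :=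
    funext fun s => h _ _
  rw [e] at h1
  exact h1.unique h2

/-! ### The product -/

theorem summable_mul (x y : β.EllOne) :
    Summable fun p : S × S => ‖x p.1‖ * ‖y p.2‖ :=
  x.summable_norm.mul_of_nonneg y.summable_norm (fun _ => norm_nonneg _) (fun _ => norm_nonneg _)

theorem summable_coeff_norm (x y : β.EllOne) :
    Summable fun p : S × S => ‖β.coeff p.1 (x p.1) (y p.2)‖ :=
  Summable.of_nonneg_of_le (fun _ => norm_nonneg _)
    (fun _ => β.norm_coeff_le (x.mem _) _) (summable_mul x y)

theorem summable_fiber (x y : β.EllOne) (s : S) :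
    Summable fun p : {p : S × S // p.1 * p.2 = s} => β.coeff p.1.1 (x p.1.1) (y p.1.2) :=
  ((summable_coeff_norm x y).subtype _).of_norm

theorem summable_fiber_norm (x y : β.EllOne) :
    Summable fun s : S => ∑' p : {p : S × S // p.1 * p.2 = s},
      ‖β.coeff p.1.1 (x p.1.1) (y p.1.2)‖ :=
  (((Equiv.sigmaFiberEquiv fun p : S × S => p.1 * p.2).summable_iff).2
    (summable_coeff_norm x y)).sigma

theorem norm_fiber_le (x y : β.EllOne) (s : S) :
    ‖∑' p : {p : S × S // p.1 * p.2 = s}, β.coeff p.1.1 (x p.1.1) (y p.1.2)‖ ≤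
      ∑' p : {p : S × S // p.1 * p.2 = s}, ‖β.coeff p.1.1 (x p.1.1) (y p.1.2)‖ :=
  norm_tsum_le_tsum_norm ((summable_coeff_norm x y).subtype _)

theorem fiber_mem (x y : β.EllOne) (s : S) :
    ∑' p : {p : S × S // p.1 * p.2 = s}, β.coeff p.1.1 (x p.1.1) (y p.1.2) ∈ β.E s := by
  refine (β.E s).isClosed.mem_of_tendsto (summable_fiber x y s).hasSum
    (Filter.Eventually.of_forall fun F => ?_)
  refine Submodule.sum_mem (β.E s).toSubmodule fun p => ?_
  intro _
  have := β.coeff_mem (x.mem p.1.1) (y.mem p.1.2)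
  rwa [p.2] at this

/-- The product `(x * y)(s) = ∑_{rt = s} β_r(β_{r⁻¹}(x(r)) y(t))`. -/
instance : Mul β.EllOne :=
  ⟨fun x y => mk (fun s => ∑' p : {p : S × S // p.1 * p.2 = s},
      β.act p.1.1 (β.act p.1.1⁻¹ (x p.1.1) * y p.1.2))
    (Summable.of_nonneg_of_le (fun _ => norm_nonneg _) (norm_fiber_le x y)
      (summable_fiber_norm x y)) (fiber_mem x y)⟩

theorem mul_apply (x y : β.EllOne) (s : S) : (x * y) s =
    ∑' p : {p : S × S // p.1 * p.2 = s}, β.coeff p.1.1 (x p.1.1) (y p.1.2) := rfl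

theorem norm_mul_le' (x y : β.EllOne) : ‖x * y‖ ≤ ‖x‖ * ‖y‖ := by
  rw [norm_def, norm_def x, norm_def y,
    x.summable_norm.tsum_mul_tsum y.summable_norm (summable_mul x y)]
  have hs := ((Equiv.sigmaFiberEquiv fun p : S × S => p.1 * p.2).summable_iff).2
    (summable_coeff_norm x y)
  calc ∑' s, ‖(x * y) s‖ ≤ ∑' s : S, ∑' p : {p : S × S // p.1 * p.2 = s},
          ‖β.coeff p.1.1 (x p.1.1) (y p.1.2)‖ :=
        Summable.tsum_le_tsum (norm_fiber_le x y) (x * y).summable_norm (summable_fiber_norm x y)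
    _ = ∑' p : S × S, ‖β.coeff p.1 (x p.1) (y p.2)‖ :=
        hs.tsum_sigma.symm.trans
          ((Equiv.sigmaFiberEquiv fun p : S × S => p.1 * p.2).tsum_eq
            (fun p : S × S => ‖β.coeff p.1 (x p.1) (y p.2)‖))
    _ ≤ _ := Summable.tsum_le_tsum (fun p => β.norm_coeff_le (x.mem _) _)
        (summable_coeff_norm x y) (summable_mul x y)

theorem add_mul' (x x' y : β.EllOne) : (x + x') * y = x * y + x' * y := by
  ext s
  rw [add_apply, mul_apply, mul_apply, mul_apply,
    ← (summable_fiber x y s).tsum_add (summable_fiber x' y s)]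
  exact tsum_congr fun p => β.coeff_add_left (x.mem _) (x'.mem _) _

theorem mul_add' (x y y' : β.EllOne) : x * (y + y') = x * y + x * y' := by
  ext s
  rw [add_apply, mul_apply, mul_apply, mul_apply,
    ← (summable_fiber x y s).tsum_add (summable_fiber x y' s)]
  exact tsum_congr fun p => β.coeff_add_right (x.mem _) _ _

theorem smul_mul' (c : ℂ) (x y : β.EllOne) : (c • x) * y = c • (x * y) := by
  ext s
  rw [smul_apply, mul_apply, mul_apply, ← ((summable_fiber x y s).hasSum.const_smul c).tsum_eq]
  exact tsum_congr fun p => β.coeff_smul_left c (x.mem p.1.1) (y p.1.2)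

theorem mul_smul' (c : ℂ) (x y : β.EllOne) : x * (c • y) = c • (x * y) := by
  ext s
  rw [smul_apply, mul_apply, mul_apply, ← ((summable_fiber x y s).hasSum.const_smul c).tsum_eq]
  exact tsum_congr fun p => β.coeff_smul_right c (x.mem p.1.1) (y p.1.2)

/-- `(a δ_r)(b δ_t) = β_r(β_{r⁻¹}(a) b) δ_{rt}`. -/
theorem delta_mul_delta (r t : S) (a : β.E r) (b : β.E t) :
    delta r a * delta t b =
      delta (r * t) ⟨β.act r (β.act r⁻¹ a * b), β.coeff_mem a.2 b.2⟩ := by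
  ext s
  rw [mul_apply]
  rcases eq_or_ne s (r * t) with rfl | h
  · rw [delta_self, tsum_eq_single ⟨(r, t), rfl⟩, delta_self, delta_self]
    · rfl
    · rintro ⟨⟨r', t'⟩, hp⟩ hne
      dsimp only
      by_cases h1 : r' = r
      · by_cases h2 : t' = t
        · subst h1 h2; exact absurd rfl hne
        · rw [delta_ne _ h2, β.coeff_zero_right]
      · rw [delta_ne _ h1, β.coeff_zero_left]
  · rw [delta_ne _ h]
    refine (tsum_congr fun p => ?_).trans tsum_zero
    obtain ⟨⟨r', t'⟩, hp⟩ := p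
    dsimp only
    by_cases h1 : r' = r
    · by_cases h2 : t' = t
      · subst h1 h2; exact absurd hp.symm h
      · rw [delta_ne _ h2, β.coeff_zero_right]
    · rw [delta_ne _ h1, β.coeff_zero_left]

/-- Left multiplication as a bounded bilinear map. -/
def mulL : β.EllOne →L[ℂ] β.EllOne →L[ℂ] β.EllOne :=
  LinearMap.mkContinuous₂
    (LinearMap.mk₂ ℂ (fun x y : β.EllOne => x * y) add_mul' smul_mul' mul_add' mul_smul') 1
    (fun x y => by rw [one_mul]; exact norm_mul_le' x y)

theorem mulL_apply (x y : β.EllOne) : mulL x y = x * y := rfl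

theorem continuous_mul_left (x : β.EllOne) : Continuous fun y => x * y := (mulL x).continuous

theorem continuous_mul_right (y : β.EllOne) : Continuous fun x : β.EllOne => x * y :=
  (mulL.flip y).continuous

/-- The maps `x ↦ x y` and `y ↦ x y` as additive maps. -/
def mulRightHom (y : β.EllOne) : β.EllOne →+ β.EllOne := AddMonoidHom.mk' (· * y) fun a b => add_mul' a b y
def mulLeftHom (x : β.EllOne) : β.EllOne →+ β.EllOne := AddMonoidHom.mk' (x * ·) (mul_add' x)

theorem mul_assoc' (x y z : β.EllOne) : (x * y) * z = x * (y * z) := by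
  have h1 : ∀ r (a : β.E r) s (b : β.E s) t (c : β.E t),
      (delta r a * delta s b) * delta t c = delta r a * (delta s b * delta t c) := by
    intro r a s b t c
    simp only [delta_mul_delta]
    have e := β.coeff_assoc a.2 b.2 (c : A)
    unfold coeff at e
    simp only [e]
    exact delta_congr (mul_assoc r s t) _ _ _
  have h2 : ∀ r (a : β.E r) s (b : β.E s) z,
      (delta r a * delta s b) * z = delta r a * (delta s b * z) := by
    intro r a s b
    exact addHom_ext (f := mulLeftHom _) (g := (mulLeftHom _).comp (mulLeftHom _))
      (continuous_mul_left _) ((continuous_mul_left _).comp (continuous_mul_left _))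
      (h1 r a s b)
  have h3 : ∀ r (a : β.E r) z y, (delta r a * y) * z = delta r a * (y * z) := by
    intro r a z
    exact addHom_ext (f := (mulRightHom z).comp (mulLeftHom _))
      (g := (mulLeftHom _).comp (mulRightHom z))
      ((continuous_mul_right _).comp (continuous_mul_left _))
      ((continuous_mul_left _).comp (continuous_mul_right _)) (fun s b => h2 r a s b z)
  exact addHom_ext (f := (mulRightHom z).comp (mulRightHom y)) (g := mulRightHom (y * z))
    ((continuous_mul_right _).comp (continuous_mul_right _)) (continuous_mul_right _)
    (fun r a => h3 r a z y) x

instance : NonUnitalRing β.EllOne :=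
  { (inferInstance : AddCommGroup β.EllOne), (inferInstance : Mul β.EllOne) with
    left_distrib := mul_add'
    right_distrib := add_mul'
    zero_mul := fun x => (mulRightHom x).map_zero
    mul_zero := fun x => (mulLeftHom x).map_zero
    mul_assoc := mul_assoc' }

instance : NonUnitalNormedRing β.EllOne :=
  { (inferInstance : NonUnitalRing β.EllOne), (inferInstance : NormedAddCommGroup β.EllOne) with
    norm_mul_le := norm_mul_le' }

instance : IsScalarTower ℂ β.EllOne β.EllOne := ⟨smul_mul'⟩
instance : SMulCommClass ℂ β.EllOne β.EllOne := ⟨fun c x y => (mul_smul' c x y).symm⟩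

/-! ### The involution -/

theorem star_coord_mem (x : β.EllOne) (s : S) : star (x s⁻¹) ∈ β.E s⁻¹ := (β.E _).star_mem (x.mem _)

/-- Inversion as a permutation of `S`. -/
def invEquiv (S : Type*) [InverseMonoid S] : S ≃ S := ⟨fun s => s⁻¹, fun s => s⁻¹, inv_inv', inv_inv'⟩

theorem norm_star_coord_le (x : β.EllOne) (s : S) :
    ‖β.act s (star (x s⁻¹))‖ ≤ ‖x s⁻¹‖ :=
  (β.norm_act_le (star_coord_mem x s)).trans (norm_star _).le

/-- The involution `x*(s) = β_s(x(s⁻¹)*)`. -/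
instance : Star β.EllOne :=
  ⟨fun x => mk (fun s => β.act s (star (x s⁻¹)))
    (Summable.of_nonneg_of_le (fun _ => norm_nonneg _) (norm_star_coord_le x)
      ((invEquiv S).summable_iff.2 x.summable_norm))
    (fun s => β.act_mem (star_coord_mem x s))⟩

theorem star_apply (x : β.EllOne) (s : S) : (star x) s = β.act s (star (x s⁻¹)) := rfl

theorem star_add' (x y : β.EllOne) : star (x + y) = star x + star y := by
  ext s
  rw [add_apply, star_apply, star_apply, star_apply, add_apply, star_add,
    β.map_add _ _ (star_coord_mem x s) _ (star_coord_mem y s)]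

theorem star_smul' (c : ℂ) (x : β.EllOne) : star (c • x) = star c • star x := by
  ext s
  rw [smul_apply, star_apply, star_apply, smul_apply, star_smul,
    β.map_smul _ _ _ (star_coord_mem x s)]

theorem star_star' (x : β.EllOne) : star (star x) = x := by
  ext s
  have h : star (x s⁻¹⁻¹) ∈ β.E s⁻¹⁻¹ := (β.E _).star_mem (x.mem _)
  rw [star_apply, star_apply, ← β.map_star _ _ h, star_star, inv_inv', β.act_act_inv (x.mem s)]

theorem norm_star_le' (x : β.EllOne) : ‖star x‖ ≤ ‖x‖ := by
  rw [norm_def, norm_def x, ← (invEquiv S).tsum_eq (fun s => ‖x s‖)]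
  exact Summable.tsum_le_tsum (norm_star_coord_le x) (star x).summable_norm
    ((invEquiv S).summable_iff.2 x.summable_norm)

/-- `(a δ_s)* = β_{s⁻¹}(a*) δ_{s⁻¹}`. -/
theorem star_delta (s : S) (a : β.E s) :
    star (delta s a) = delta s⁻¹ ⟨β.act s⁻¹ (star (a : A)), β.act_inv_mem ((β.E s).star_mem a.2)⟩ := by
  ext t
  rw [star_apply]
  rcases eq_or_ne t s⁻¹ with rfl | h
  · have : delta s a s⁻¹⁻¹ = a := by rw [inv_inv', delta_self]
    rw [this, delta_self]
  · have h' : t⁻¹ ≠ s := fun e => h (by rw [← e, inv_inv'])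
    rw [delta_ne _ h, delta_ne _ h', star_zero, β.act_zero]

/-- The involution as an additive map. -/
def starHom : β.EllOne →+ β.EllOne := AddMonoidHom.mk' star star_add'

theorem continuous_starHom : Continuous (starHom : β.EllOne →+ β.EllOne) :=
  AddMonoidHomClass.continuous_of_bound starHom 1 fun x => by
    rw [one_mul]; exact norm_star_le' x

theorem star_mul' (x y : β.EllOne) : star (x * y) = star y * star x := by
  have h1 : ∀ r (a : β.E r) s (b : β.E s),
      star (delta r a * delta s b) = star (delta s b) * star (delta r a) := by
    intro r a s b
    simp only [delta_mul_delta, star_delta]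
    have e := β.star_coeff a.2 b.2
    unfold coeff at e
    simp only [e]
    exact delta_congr (mul_inv_rev' r s) _ _ _
  have h2 : ∀ r (a : β.E r) y, star (delta r a * y) = star y * star (delta r a) := by
    intro r a
    exact addHom_ext (f := starHom.comp (mulLeftHom _)) (g := (mulRightHom _).comp starHom)
      (continuous_starHom.comp (continuous_mul_left _))
      ((continuous_mul_right _).comp continuous_starHom) (h1 r a)
  exact addHom_ext (f := starHom.comp (mulRightHom _)) (g := (mulLeftHom _).comp starHom)
      (continuous_starHom.comp (continuous_mul_right _))
      ((continuous_mul_left _).comp continuous_starHom) (fun r a => h2 r a y) x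

instance : StarRing β.EllOne where
  star_involutive := star_star'
  star_mul := star_mul'
  star_add := star_add'

instance : StarModule ℂ β.EllOne := ⟨star_smul'⟩

end EllOne

end CStarAction

/-! ## Quotients of *-algebras -/

/-- The (two-sided) ideal of the complex algebra `B` generated by `s`: the intersection of all
linear subspaces that contain `s` and are stable under multiplication by `B` on both sides. -/
def algIdealSpan {B : Type*} [NonUnitalRing B] [Module ℂ B] (s : Set B) : Submodule ℂ B :=
  sInf {J | s ⊆ J ∧ ∀ x ∈ J, ∀ b : B, b * x ∈ J ∧ x * b ∈ J}

/-- A self-adjoint two-sided ideal of a complex *-algebra. -/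
structure StarIdeal (B : Type*) [NonUnitalRing B] [StarRing B] [Module ℂ B] extends
    Submodule ℂ B where
  mul_mem' : ∀ x ∈ carrier, ∀ b : B, b * x ∈ carrier ∧ x * b ∈ carrier
  star_mem' : ∀ x ∈ carrier, star x ∈ carrier

/-- The ideal generated by a self-adjoint set. -/
def StarIdeal.span {B : Type*} [NonUnitalRing B] [StarRing B] [Module ℂ B] [StarModule ℂ B]
    (s : Set B) (hs : ∀ x ∈ s, star x ∈ s) : StarIdeal B where
  toSubmodule := algIdealSpan s
  mul_mem' x hx b := by
    change x ∈ algIdealSpan s at hx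
    change _ ∈ algIdealSpan s ∧ _ ∈ algIdealSpan s
    rw [algIdealSpan, Submodule.mem_sInf] at hx ⊢
    rw [Submodule.mem_sInf]
    exact ⟨fun J hJ => (hJ.2 x (hx J hJ) b).1, fun J hJ => (hJ.2 x (hx J hJ) b).2⟩
  star_mem' x hx := by
    change x ∈ algIdealSpan s at hx
    change _ ∈ algIdealSpan s
    rw [algIdealSpan, Submodule.mem_sInf] at hx ⊢
    intro J hJ
    let J' : Submodule ℂ B :=
      { carrier := {y | star y ∈ J}
        zero_mem' := by simp
        add_mem' := fun {a b} ha hb => by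
          rw [Set.mem_ofPred_eq, star_add]; exact J.add_mem ha hb
        smul_mem' := fun c y hy => by
          rw [Set.mem_ofPred_eq, star_smul]; exact J.smul_mem _ hy }
    refine hx J' ⟨fun y hy => hJ.1 (hs y hy), fun y hy b => ⟨?_, ?_⟩⟩
    · change star (b * y) ∈ J
      rw [star_mul]; exact (hJ.2 _ hy _).2
    · change star (y * b) ∈ J
      rw [star_mul]; exact (hJ.2 _ hy _).1

namespace StarIdeal

variable {B : Type*} [NonUnitalRing B] [StarRing B] [Module ℂ B] (I : StarIdeal B)

/-- The quotient *-algebra `B ⧸ I`. -/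
def Quotient : Type _ := B ⧸ I.toSubmodule

instance : AddCommGroup I.Quotient := inferInstanceAs (AddCommGroup (B ⧸ I.toSubmodule))
instance : Module ℂ I.Quotient := inferInstanceAs (Module ℂ (B ⧸ I.toSubmodule))

/-- The class of an element. -/
def cls (x : B) : I.Quotient := Submodule.Quotient.mk x

theorem cls_surjective : Function.Surjective I.cls := Submodule.Quotient.mk_surjective _

theorem cls_eq {x y : B} : I.cls x = I.cls y ↔ x - y ∈ I.toSubmodule := Submodule.Quotient.eq _

instance : Mul I.Quotient :=
  ⟨_root_.Quotient.map₂ (fun x y : B => x * y) fun x x' hx y y' hy => by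
    have hx' : x - x' ∈ I.toSubmodule := (Submodule.quotientRel_def _).1 hx
    have hy' : y - y' ∈ I.toSubmodule := (Submodule.quotientRel_def _).1 hy
    refine (Submodule.quotientRel_def _).2 ?_
    have e : x * y - x' * y' = (x - x') * y + x' * (y - y') := by noncomm_ring
    rw [e]
    exact I.toSubmodule.add_mem (I.mul_mem' _ hx' y).2 (I.mul_mem' _ hy' x').1⟩

instance : Star I.Quotient :=
  ⟨_root_.Quotient.map (fun x : B => star x) fun x x' hx => by
    have hx' : x - x' ∈ I.toSubmodule := (Submodule.quotientRel_def _).1 hx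
    refine (Submodule.quotientRel_def _).2 ?_
    rw [← star_sub]
    exact I.star_mem' _ hx'⟩

theorem cls_add (x y : B) : I.cls (x + y) = I.cls x + I.cls y := rfl
theorem cls_zero : I.cls 0 = 0 := rfl
theorem cls_smul (c : ℂ) (x : B) : I.cls (c • x) = c • I.cls x := rfl
theorem cls_mul (x y : B) : I.cls (x * y) = I.cls x * I.cls y := rfl
theorem cls_star (x : B) : I.cls (star x) = star (I.cls x) := rfl

instance : NonUnitalRing I.Quotient :=
  { (inferInstance : AddCommGroup I.Quotient), (inferInstance : Mul I.Quotient) with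
    zero_mul := I.cls_surjective.forall.2 fun x => by rw [← cls_zero, ← cls_mul, zero_mul]
    mul_zero := I.cls_surjective.forall.2 fun x => by rw [← cls_zero, ← cls_mul, mul_zero]
    mul_assoc := I.cls_surjective.forall₃.2 fun x y z => by simp only [← cls_mul, mul_assoc]
    left_distrib := I.cls_surjective.forall₃.2 fun x y z => by
      simp only [← cls_mul, ← cls_add, mul_add]
    right_distrib := I.cls_surjective.forall₃.2 fun x y z => by
      simp only [← cls_mul, ← cls_add, add_mul] }

instance : StarRing I.Quotient where
  star_involutive := I.cls_surjective.forall.2 fun x => by simp only [← cls_star, star_star]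
  star_mul := I.cls_surjective.forall₂.2 fun x y => by simp only [← cls_star, ← cls_mul, star_mul]
  star_add := I.cls_surjective.forall₂.2 fun x y => by simp only [← cls_star, ← cls_add, star_add]

instance [IsScalarTower ℂ B B] : IsScalarTower ℂ I.Quotient I.Quotient :=
  ⟨fun c => I.cls_surjective.forall₂.2 fun x y => by
    simp only [smul_eq_mul, ← cls_smul, ← cls_mul, smul_mul_assoc]⟩

instance [SMulCommClass ℂ B B] : SMulCommClass ℂ I.Quotient I.Quotient :=
  ⟨fun c => I.cls_surjective.forall₂.2 fun x y => by
    simp only [smul_eq_mul, ← cls_smul, ← cls_mul, mul_smul_comm]⟩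

instance [StarModule ℂ B] : StarModule ℂ I.Quotient :=
  ⟨fun c => I.cls_surjective.forall.2 fun x => by
    simp only [← cls_smul, ← cls_star, star_smul]⟩

end StarIdeal

/-! ## The algebraic partial crossed product and the partial crossed product -/

namespace CStarAction

open InverseMonoid

variable {S A : Type*} [InverseMonoid S] [NonUnitalCStarAlgebra A] (β : CStarAction S A)

/-- The *-algebra `L` of finite sums `∑ a_s δ_s`, `a_s ∈ E s`, with
`(a δ_r)(b δ_t) = β_r(β_{r⁻¹}(a) b) δ_{rt}` and `(a δ_s)* = β_{s⁻¹}(a*) δ_{s⁻¹}`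
(see `EllOne.delta_mul_delta`, `EllOne.star_delta` and `sum_delta`), realised as the
*-subalgebra of the finitely supported elements of `L̃`. -/
def finSupp : NonUnitalStarSubalgebra ℂ β.EllOne where
  carrier := {x | {s | x s ≠ 0}.Finite}
  zero_mem' := by
    have : {s : S | (0 : β.EllOne) s ≠ 0} = ∅ := by ext s; simp [EllOne.zero_apply]
    rw [Set.mem_ofPred_eq, this]; exact Set.finite_empty
  add_mem' {x y} hx hy := (hx.union hy).subset fun s hs => by
    by_contra h
    simp only [Set.mem_union, Set.mem_ofPred_eq, not_or, not_not] at h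
    exact hs (by rw [EllOne.add_apply, h.1, h.2, add_zero])
  smul_mem' c x hx := Set.Finite.subset hx fun s hs h => hs (by rw [EllOne.smul_apply, h, smul_zero])
  mul_mem' {x y} hx hy := (Set.Finite.image2 (· * ·) hx hy).subset fun s hs => by
    by_contra h
    refine hs ?_
    rw [EllOne.mul_apply]
    refine (tsum_congr fun p => ?_).trans tsum_zero
    by_cases h1 : x p.1.1 = 0
    · rw [h1, β.coeff_zero_left]
    · by_cases h2 : y p.1.2 = 0
      · rw [h2, β.coeff_zero_right]
      · exact absurd ⟨_, h1, _, h2, p.2⟩ h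
  star_mem' {x} hx := (Set.Finite.image (fun s => s⁻¹) hx).subset fun s hs =>
    ⟨s⁻¹, fun h => hs (by rw [EllOne.star_apply, h, star_zero, β.act_zero]), inv_inv' s⟩

/-- The *-algebra `L`. -/
abbrev L : Type _ := β.finSupp

variable {β} in
/-- The element `a δ_s` of `L`. -/
def deltaL (s : S) (a : β.E s) : β.L :=
  ⟨EllOne.delta s a, (Set.finite_singleton s).subset fun t ht => by
    by_contra h
    exact ht (EllOne.delta_ne a h)⟩

variable {β} in
/-- Every element of `L` is a finite sum of elements `a_s δ_s`. -/
theorem sum_delta (x : β.L) :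
    x = ∑ s ∈ x.2.toFinset, deltaL s ⟨x.1 s, x.1.mem s⟩ := by
  apply Subtype.ext
  rw [AddSubmonoidClass.coe_finsetSum]
  refine (EllOne.hasSum_delta x.1).unique ?_
  refine hasSum_sum_of_ne_finset_zero fun s hs => ?_
  have h0 : x.1 s = 0 := by
    by_contra h
    exact hs ((Set.Finite.mem_toFinset _).2 h)
  ext t
  rw [EllOne.zero_apply]
  rcases eq_or_ne t s with rfl | h
  · rw [EllOne.delta_self]; exact h0
  · rw [EllOne.delta_ne _ h]

/-- The generators `a δ_r - a δ_t`, for `r ≤ t` and `a ∈ E r` (so that `a ∈ E t` as well). -/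
def generatorsN : Set β.L :=
  {x | ∃ (r t : S) (h : NatLE r t) (a : A) (ha : a ∈ β.E r),
    x = deltaL r ⟨a, ha⟩ - deltaL t ⟨a, β.mem_of_natLE h ha⟩}

theorem star_mem_generatorsN (x : β.L) (hx : x ∈ β.generatorsN) : star x ∈ β.generatorsN := by
  obtain ⟨r, t, h, a, ha, rfl⟩ := hx
  refine ⟨r⁻¹, t⁻¹, h.inv, β.act r⁻¹ (star a), β.act_inv_mem ((β.E r).star_mem ha), ?_⟩
  apply Subtype.ext
  rw [star_sub]
  have e := β.act_inv_natLE h ((β.E r).star_mem ha)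
  change star (EllOne.delta r _) - star (EllOne.delta t _) = EllOne.delta _ _ - EllOne.delta _ _
  rw [EllOne.star_delta, EllOne.star_delta]
  simp only [e]

/-- The ideal `N` of `L` generated by the elements `a δ_r - a δ_t`, for `r ≤ t` and `a ∈ E r`. -/
def N : StarIdeal β.L := StarIdeal.span β.generatorsN β.star_mem_generatorsN

/-- The algebraic partial crossed product `L ⧸ N`. -/
abbrev AlgCrossedProduct : Type _ := β.N.Quotient

theorem cls_delta_eq {r t : S} (h : NatLE r t) (a : A) (ha : a ∈ β.E r) :
    β.N.cls (deltaL r ⟨a, ha⟩) = β.N.cls (deltaL t ⟨a, β.mem_of_natLE h ha⟩) := by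
  rw [StarIdeal.cls_eq]
  change _ ∈ algIdealSpan β.generatorsN
  rw [algIdealSpan, Submodule.mem_sInf]
  exact fun J hJ => hJ.1 ⟨r, t, h, a, ha, rfl⟩

theorem act_one (a : A) : β.act 1 a = a := β.act_idem (mul_one 1) (β.E_one a)

/-- The *-homomorphism `a ↦ a δ_1` from `A` to `L ⧸ N`. -/
def unitHom : A →⋆ₙₐ[ℂ] β.AlgCrossedProduct where
  toFun a := β.N.cls (deltaL 1 ⟨a, β.E_one a⟩)
  map_smul' c a := congrArg β.N.cls (Subtype.ext
    (EllOne.delta_smul (β := β) 1 c ⟨a, β.E_one a⟩ (β.E_one _)))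
  map_zero' := congrArg β.N.cls (Subtype.ext (by
    have := EllOne.delta_smul (β := β) 1 0 ⟨0, β.E_one 0⟩ (β.E_one _)
    simp only [zero_smul] at this
    exact this))
  map_add' a b := congrArg β.N.cls (Subtype.ext
    (EllOne.delta_add (β := β) 1 ⟨a, β.E_one a⟩ ⟨b, β.E_one b⟩ (β.E_one _)))
  map_mul' a b := congrArg β.N.cls (Subtype.ext (by
    change EllOne.delta 1 _ = EllOne.delta 1 _ * EllOne.delta 1 _
    rw [EllOne.delta_mul_delta]
    simp only [one_inv', β.act_one]
    exact EllOne.delta_congr (mul_one 1).symm _ _ _))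
  map_star' a := congrArg β.N.cls (Subtype.ext (by
    change EllOne.delta 1 _ = star (EllOne.delta 1 _)
    rw [EllOne.star_delta]
    simp only [one_inv', β.act_one]
    exact EllOne.delta_congr one_inv'.symm _ _ _))

theorem norm_hom_delta_le (ρ : StarRep β.AlgCrossedProduct) (s : S) (a : β.E s) :
    ‖ρ.hom (β.N.cls (deltaL s a))‖ ≤ ‖(a : A)‖ := by
  have hf : NatLE (s⁻¹ * s) 1 := ⟨s⁻¹ * s, inv_mul_idem s, (one_mul _).symm⟩
  have key : star (β.N.cls (deltaL s a)) * β.N.cls (deltaL s a) =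
      β.unitHom (β.coeff s⁻¹ (β.act s⁻¹ (star (a : A))) a) := by
    have hm := β.coeff_mem (β.act_inv_mem ((β.E s).star_mem a.2)) a.2
    rw [← StarIdeal.cls_star, ← StarIdeal.cls_mul]
    refine Eq.trans ?_ (β.cls_delta_eq hf _ hm)
    congr 1
    apply Subtype.ext
    change star (EllOne.delta _ _) * EllOne.delta _ _ = EllOne.delta _ _
    rw [EllOne.star_delta, EllOne.delta_mul_delta]
    rfl
  have h1 : ‖ρ.hom (β.N.cls (deltaL s a))‖ * ‖ρ.hom (β.N.cls (deltaL s a))‖ ≤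
      ‖(a : A)‖ * ‖(a : A)‖ := by
    rw [← CStarRing.norm_star_mul_self, ← StarHomClass.map_star ρ.hom, ← _root_.map_mul, key]
    refine (NonUnitalStarAlgHom.norm_apply_le (ρ.hom.comp β.unitHom) _).trans ?_
    refine (β.norm_coeff_le (β.act_inv_mem ((β.E s).star_mem a.2)) _).trans ?_
    refine mul_le_mul_of_nonneg_right ?_ (norm_nonneg _)
    refine (β.norm_act_le (β.inv_inv_mem ((β.E s).star_mem a.2))).trans ?_
    exact (norm_star _).le
  exact abs_le_of_sq_le_sq' (by simpa [pow_two] using h1) (norm_nonneg _) |>.2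

theorem norm_hom_le (ρ : StarRep β.AlgCrossedProduct) (x : β.L) :
    ‖ρ.hom (β.N.cls x)‖ ≤ ∑ s ∈ x.2.toFinset, ‖x.1 s‖ := by
  let g : β.L →+ (ρ.H →L[ℂ] ρ.H) :=
    AddMonoidHom.mk' (fun y => ρ.hom (β.N.cls y)) fun y z => by
      rw [StarIdeal.cls_add, _root_.map_add]
  have e : ρ.hom (β.N.cls x) = ∑ s ∈ x.2.toFinset, g (deltaL s ⟨x.1 s, x.1.mem s⟩) := by
    rw [← map_sum, ← sum_delta]; rfl
  rw [e]
  exact norm_sum_le_of_le _ fun s _ => β.norm_hom_delta_le ρ s _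

theorem bddAbove_hom (x : β.AlgCrossedProduct) :
    BddAbove (Set.range fun ρ : StarRep β.AlgCrossedProduct => ‖ρ.hom x‖) := by
  obtain ⟨y, rfl⟩ := β.N.cls_surjective x
  exact ⟨_, by rintro _ ⟨ρ, rfl⟩; exact β.norm_hom_le ρ y⟩

/-- The universal C*-seminorm of `L ⧸ N`, the supremum over its representations. -/
def algSeminorm : CStarSeminorm β.AlgCrossedProduct :=
  envelopingSeminorm β.AlgCrossedProduct β.bddAbove_hom

/-- The partial crossed product of `β`: the enveloping C*-algebra of `L ⧸ N`. -/
abbrev PartialCrossedProduct : Type _ :=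
  EnvelopingCStarAlgebra β.AlgCrossedProduct β.bddAbove_hom

/-- The canonical map `L → L ⧸ N → C*(L ⧸ N)`. -/
def toPartialCrossedProduct (x : β.L) : β.PartialCrossedProduct :=
  (envelopingSeminorm β.AlgCrossedProduct β.bddAbove_hom).toCompletion (β.N.cls x)

/-! ## Covariant representations and Sieben's crossed product -/

/-- A covariant representation `(π, ν, H)` of `β` on the Hilbert space `H`. -/
structure CovRep.{w, u, v} {S : Type u} {A : Type v} [InverseMonoid S] [NonUnitalCStarAlgebra A]
    (β : CStarAction S A) where
  H : Type w
  [normedAddCommGroup : NormedAddCommGroup H]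
  [innerProductSpace : InnerProductSpace ℂ H]
  [completeSpace : CompleteSpace H]
  π : A →⋆ₙₐ[ℂ] (H →L[ℂ] H)
  ν : S → H →L[ℂ] H
  /-- `ν_s` is a partial isometry -/
  partialIsometry : ∀ s, ν s * star (ν s) * ν s = ν s
  map_mul : ∀ s t, ν (s * t) = ν s * ν t
  /-- the covariance condition -/
  covariant : ∀ s, ∀ a ∈ β.E s⁻¹, ν s * π a * ν s⁻¹ = π (β.act s a)
  /-- the initial space of `ν_s` is the closed span of `π(E s⁻¹) H` -/
  initial : ∀ s, (LinearMap.ker (ν s).toLinearMap)ᗮ =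
    (Submodule.span ℂ {y | ∃ a ∈ β.E s⁻¹, ∃ h : H, y = π a h}).topologicalClosure
  /-- the final space of `ν_s` is the closed span of `π(E s) H` -/
  final : ∀ s, LinearMap.range (ν s).toLinearMap =
    (Submodule.span ℂ {y | ∃ a ∈ β.E s, ∃ h : H, y = π a h}).topologicalClosure

attribute [instance] CovRep.normedAddCommGroup CovRep.innerProductSpace CovRep.completeSpace

namespace CovRep

variable {β} (c : CovRep β)

instance : Inhabited (CovRep β) :=
  ⟨{ H := PUnit
     π := 0
     ν := 0
     partialIsometry := fun s => by simp
     map_mul := fun s t => by simp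
     covariant := fun s a _ => by simp
     initial := fun s => Subsingleton.elim _ _
     final := fun s => Subsingleton.elim _ _ }⟩

theorem star_ν_idem {f : S} (hf : f * f = f) : star (c.ν f) = c.ν f := by
  have hi := inv_of_idem hf
  have hPP : ∀ x, c.ν f (c.ν f x) = c.ν f x := fun x => by
    have := c.map_mul f f
    rw [hf] at this
    exact (congrArg (fun T : c.H →L[ℂ] c.H => T x) this).symm
  have hr : (LinearMap.ker (c.ν f).toLinearMap)ᗮ = LinearMap.range (c.ν f).toLinearMap := by
    rw [c.initial, c.final, hi]
  have hk : ∀ x, x - c.ν f x ∈ LinearMap.ker (c.ν f).toLinearMap := fun x => by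
    rw [LinearMap.mem_ker]
    change c.ν f (x - c.ν f x) = 0
    rw [_root_.map_sub, hPP, sub_self]
  have hR : ∀ x, c.ν f x ∈ (LinearMap.ker (c.ν f).toLinearMap)ᗮ := fun x => by
    rw [hr]; exact ⟨x, rfl⟩
  have : IsSelfAdjoint (c.ν f) := by
    rw [ContinuousLinearMap.isSelfAdjoint_iff_isSymmetric]
    intro x y
    change ⟪c.ν f x, y⟫_ℂ = ⟪x, c.ν f y⟫_ℂ
    have h1 : ⟪c.ν f x, y - c.ν f y⟫_ℂ = 0 := Submodule.inner_left_of_mem_orthogonal (hk y) (hR x)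
    have h2 : ⟪x - c.ν f x, c.ν f y⟫_ℂ = 0 := Submodule.inner_right_of_mem_orthogonal (hk x) (hR y)
    rw [inner_sub_right, sub_eq_zero] at h1
    rw [inner_sub_left, sub_eq_zero] at h2
    rw [h1, h2]
  exact this

theorem star_ν (s : S) : star (c.ν s) = c.ν s⁻¹ := by
  have hP : star (c.ν s * c.ν s⁻¹) = c.ν s * c.ν s⁻¹ := by
    rw [← c.map_mul]; exact c.star_ν_idem (mul_inv_idem s)
  have hQ : star (c.ν s⁻¹ * c.ν s) = c.ν s⁻¹ * c.ν s := by
    rw [← c.map_mul]; exact c.star_ν_idem (inv_mul_idem s)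
  have h1 : c.ν s * c.ν s⁻¹ * c.ν s = c.ν s := by
    rw [← c.map_mul, ← c.map_mul, mul_inv_mul]
  have h2 : c.ν s⁻¹ * c.ν s * c.ν s⁻¹ = c.ν s⁻¹ := by
    rw [← c.map_mul, ← c.map_mul, inv_mul_inv]
  have h3 := c.partialIsometry s
  generalize c.ν s = U at *
  generalize c.ν s⁻¹ = V at *
  have e1 : V * (U * star U) = V := by
    calc V * (U * star U) = V * star (U * star U) := by rw [star_mul, star_star]
      _ = V * star ((U * V * U) * star U) := by rw [h1]
      _ = V * star ((U * V) * (U * star U)) := by simp only [mul_assoc]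
      _ = V * ((U * star U) * (U * V)) := by rw [star_mul, hP, star_mul, star_star]
      _ = V * ((U * star U * U) * V) := by simp only [mul_assoc]
      _ = V := by rw [h3, ← mul_assoc, h2]
  calc star U = star (U * (V * U)) := by rw [← mul_assoc, h1]
    _ = (V * U) * star U := by rw [star_mul, hQ]
    _ = V := by rw [mul_assoc, e1]

theorem norm_ν_le (s : S) : ‖c.ν s‖ ≤ 1 := by
  have h3 := c.partialIsometry s
  set U := c.ν s
  have hp : (star U * U) * (star U * U) = star U * U := by
    calc (star U * U) * (star U * U) = star U * (U * star U * U) := by simp only [mul_assoc]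
      _ = _ := by rw [h3]
  have hn : ‖star U * U‖ * ‖star U * U‖ = ‖star U * U‖ := by
    rw [← CStarRing.norm_star_mul_self, star_mul, star_star, hp]
  rw [CStarRing.norm_star_mul_self] at hn
  by_contra h
  push Not at h
  nlinarith [mul_pos (by linarith : 0 < ‖U‖) (by linarith : 0 < ‖U‖),
    mul_lt_mul'' h h zero_le_one zero_le_one]

theorem ν_mul_π {s : S} {a : A} (ha : a ∈ β.E s) : c.ν (s * s⁻¹) * c.π a = c.π a := by
  ext h
  have hm : c.π a h ∈ LinearMap.range (c.ν s).toLinearMap := by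
    rw [c.final]
    exact Submodule.le_topologicalClosure _ (Submodule.subset_span ⟨a, ha, h, rfl⟩)
  obtain ⟨k, hk⟩ := hm
  have hk' : c.ν s k = c.π a h := hk
  change c.ν (s * s⁻¹) (c.π a h) = c.π a h
  rw [← hk']
  have := c.map_mul (s * s⁻¹) s
  rw [mul_inv_mul] at this
  exact (congrArg (fun T : c.H →L[ℂ] c.H => T k) this).symm

theorem π_mul_ν {s : S} {a : A} (ha : a ∈ β.E s) : c.π a * c.ν (s * s⁻¹) = c.π a := by
  have h := congrArg star (c.ν_mul_π ((β.E s).star_mem ha))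
  rwa [star_mul, ← StarHomClass.map_star, star_star, c.star_ν_idem (mul_inv_idem s)] at h

theorem π_mul_ν' {s : S} {a : A} (ha : a ∈ β.E s⁻¹) : c.π a * c.ν (s⁻¹ * s) = c.π a := by
  have := c.π_mul_ν ha
  rwa [inv_inv'] at this

theorem term_mul {r t : S} {a b : A} (ha : a ∈ β.E r) :
    c.π (β.coeff r a b) * c.ν (r * t) = (c.π a * c.ν r) * (c.π b * c.ν t) := by
  set d := β.act r⁻¹ a with hd
  have hdr : d ∈ β.E r⁻¹ := β.act_inv_mem ha
  have hdb : d * b ∈ β.E r⁻¹ := (β.E _).mul_mem_right _ hdr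
  have e1 : c.ν r * c.π d = c.π a * c.ν r := by
    calc c.ν r * c.π d = c.ν r * (c.π d * c.ν (r⁻¹ * r)) := by rw [c.π_mul_ν' hdr]
      _ = (c.ν r * c.π d * c.ν r⁻¹) * c.ν r := by rw [c.map_mul]; simp only [mul_assoc]
      _ = c.π a * c.ν r := by rw [c.covariant r d hdr, hd, β.act_act_inv ha]
  calc c.π (β.coeff r a b) * c.ν (r * t)
      = (c.ν r * c.π (d * b) * c.ν r⁻¹) * (c.ν r * c.ν t) := by
        rw [c.covariant r _ hdb, c.map_mul]; rfl
    _ = c.ν r * (c.π (d * b) * c.ν (r⁻¹ * r)) * c.ν t := by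
        rw [c.map_mul r⁻¹ r]; simp only [mul_assoc]
    _ = (c.ν r * c.π d) * c.π b * c.ν t := by
        rw [c.π_mul_ν' hdb, _root_.map_mul]; simp only [mul_assoc]
    _ = _ := by rw [e1]; simp only [mul_assoc]

theorem term_star {s : S} {a : A} (ha : a ∈ β.E s) :
    c.π (β.act s⁻¹ (star a)) * c.ν s⁻¹ = star (c.π a * c.ν s) := by
  have ha' := (β.E s).star_mem ha
  have h := c.covariant s⁻¹ (star a) (β.inv_inv_mem ha')
  rw [inv_inv'] at h
  rw [← h, star_mul, c.star_ν, ← StarHomClass.map_star]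
  calc c.ν s⁻¹ * c.π (star a) * c.ν s * c.ν s⁻¹
      = c.ν s⁻¹ * (c.π (star a) * c.ν (s * s⁻¹)) := by rw [c.map_mul]; simp only [mul_assoc]
    _ = _ := by rw [c.π_mul_ν ha']

theorem norm_term_le (a : A) (s : S) : ‖c.π a * c.ν s‖ ≤ ‖a‖ := by
  refine (norm_mul_le _ _).trans ?_
  calc ‖c.π a‖ * ‖c.ν s‖ ≤ ‖a‖ * 1 :=
        mul_le_mul (NonUnitalStarAlgHom.norm_apply_le c.π a) (c.norm_ν_le s) (norm_nonneg _)
          (norm_nonneg _)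
    _ = _ := mul_one _

theorem summable_term (x : β.EllOne) : Summable fun s => c.π (x s) * c.ν s :=
  (Summable.of_nonneg_of_le (fun _ => norm_nonneg _) (fun s => c.norm_term_le (x s) s)
    x.summable_norm).of_norm

/-- The map `(π × ν)(x) = ∑_s π(x(s)) ν_s` on `L̃`. -/
def integratedFun (x : β.EllOne) : c.H →L[ℂ] c.H := ∑' s, c.π (x s) * c.ν s

theorem norm_integratedFun_le (x : β.EllOne) : ‖c.integratedFun x‖ ≤ ‖x‖ := by
  rw [EllOne.norm_def]
  have h := Summable.of_nonneg_of_le (fun _ => norm_nonneg _) (fun s => c.norm_term_le (x s) s)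
    x.summable_norm
  exact (norm_tsum_le_tsum_norm h).trans
    (Summable.tsum_le_tsum (fun s => c.norm_term_le (x s) s) h x.summable_norm)

theorem integratedFun_add (x y : β.EllOne) :
    c.integratedFun (x + y) = c.integratedFun x + c.integratedFun y := by
  unfold integratedFun
  rw [← (c.summable_term x).tsum_add (c.summable_term y)]
  exact tsum_congr fun s => by rw [EllOne.add_apply, _root_.map_add, add_mul]

theorem integratedFun_smul (k : ℂ) (x : β.EllOne) :
    c.integratedFun (k • x) = k • c.integratedFun x := by
  unfold integratedFun
  rw [← ((c.summable_term x).hasSum.const_smul k).tsum_eq]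
  exact tsum_congr fun s => by rw [EllOne.smul_apply, _root_.map_smul, smul_mul_assoc]

theorem integratedFun_delta (s : S) (a : β.E s) :
    c.integratedFun (EllOne.delta s a) = c.π a * c.ν s := by
  unfold integratedFun
  rw [tsum_eq_single s fun t ht => by rw [EllOne.delta_ne _ ht, _root_.map_zero, zero_mul],
    EllOne.delta_self]

/-- `π × ν` as an additive map. -/
def integratedAdd : β.EllOne →+ (c.H →L[ℂ] c.H) :=
  AddMonoidHom.mk' c.integratedFun c.integratedFun_add

theorem continuous_integratedAdd : Continuous c.integratedAdd :=
  AddMonoidHomClass.continuous_of_bound c.integratedAdd 1 fun x => by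
    rw [one_mul]; exact c.norm_integratedFun_le x

theorem integratedFun_mul (x y : β.EllOne) :
    c.integratedFun (x * y) = c.integratedFun x * c.integratedFun y := by
  have h1 : ∀ r (a : β.E r) s (b : β.E s),
      c.integratedFun (EllOne.delta r a * EllOne.delta s b) =
        c.integratedFun (EllOne.delta r a) * c.integratedFun (EllOne.delta s b) := by
    intro r a s b
    rw [EllOne.delta_mul_delta, integratedFun_delta, integratedFun_delta, integratedFun_delta,
      ← c.term_mul a.2]
    rfl
  have h2 : ∀ r (a : β.E r) y, c.integratedFun (EllOne.delta r a * y) =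
        c.integratedFun (EllOne.delta r a) * c.integratedFun y := by
    intro r a
    exact EllOne.addHom_ext (f := c.integratedAdd.comp (EllOne.mulLeftHom _))
      (g := (AddMonoidHom.mulLeft (c.integratedFun (EllOne.delta r a))).comp c.integratedAdd)
      (c.continuous_integratedAdd.comp (EllOne.continuous_mul_left _))
      (continuous_const.mul c.continuous_integratedAdd) (h1 r a)
  exact EllOne.addHom_ext (f := c.integratedAdd.comp (EllOne.mulRightHom y))
      (g := (AddMonoidHom.mulRight (c.integratedFun y)).comp c.integratedAdd)
      (c.continuous_integratedAdd.comp (EllOne.continuous_mul_right _))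
      (c.continuous_integratedAdd.mul continuous_const) (fun r a => h2 r a y) x

theorem integratedFun_star (x : β.EllOne) :
    c.integratedFun (star x) = star (c.integratedFun x) := by
  refine EllOne.addHom_ext (f := c.integratedAdd.comp EllOne.starHom)
    (g := (starAddEquiv : (c.H →L[ℂ] c.H) ≃+ _).toAddMonoidHom.comp c.integratedAdd)
    (c.continuous_integratedAdd.comp EllOne.continuous_starHom)
    (continuous_star.comp c.continuous_integratedAdd) (fun s a => ?_) x
  change c.integratedFun (star (EllOne.delta s a)) = star (c.integratedFun (EllOne.delta s a))
  rw [EllOne.star_delta, integratedFun_delta, integratedFun_delta]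
  exact c.term_star a.2

/-- The integrated form `π × ν : L̃ → B(H)`, `(π × ν)(x) = ∑_s π(x(s)) ν_s`, a *-homomorphism. -/
def integrated : β.EllOne →⋆ₙₐ[ℂ] (c.H →L[ℂ] c.H) where
  toFun := c.integratedFun
  map_smul' := c.integratedFun_smul
  map_zero' := c.integratedAdd.map_zero
  map_add' := c.integratedFun_add
  map_mul' := c.integratedFun_mul
  map_star' := c.integratedFun_star

/-- The integrated form, as a representation of `L̃`. -/
def toStarRep : StarRep β.EllOne where
  H := c.H
  hom := c.integrated

end CovRep

theorem bddAbove_integrated.{u, v} {S : Type u} {A : Type v} [InverseMonoid S]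
    [NonUnitalCStarAlgebra A] (β : CStarAction S A) (x : β.EllOne) :
    BddAbove (Set.range fun c : CovRep.{max u v} β => ‖c.toStarRep.hom x‖) :=
  ⟨‖x‖, by rintro _ ⟨c, rfl⟩; exact c.norm_integratedFun_le x⟩

/-- Sieben's seminorm `‖x‖_c = sup {‖(π × ν)(x)‖ : (π, ν, H) a covariant representation of β}` on
`L̃`. The Hilbert spaces range over the universe of `S` and `A`, which is that of `L̃`; as for
`envelopingSeminorm`, this gives the supremum over all covariant representations. -/
def siebenSeminorm.{u, v} {S : Type u} {A : Type v} [InverseMonoid S]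
    [NonUnitalCStarAlgebra A] (β : CStarAction S A) : CStarSeminorm β.EllOne :=
  StarRep.supSeminorm (fun c : CovRep.{max u v} β => c.toStarRep) β.bddAbove_integrated

/-- Sieben's crossed product: the completion of `L̃ ⧸ {x | ‖x‖_c = 0}` with respect to `‖·‖_c`. -/
abbrev SiebenCrossedProduct : Type _ := β.siebenSeminorm.Completion

/-- The canonical map from `L̃` to Sieben's crossed product. -/
def toSiebenCrossedProduct (x : β.EllOne) : β.SiebenCrossedProduct :=
  β.siebenSeminorm.toCompletion x

end CStarAction

end

/-!
The two seminorms agree on `L` because representations of `L ⧸ N` and covariant representations of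
`β` are the same thing, up to vectors on which everything vanishes.

A covariant representation `(π, ν, H)` has `π(a)ν_r = π(a)ν_t` for `r ≤ t` and `a ∈ E r`
(`CovRep.π_mul_ν_eq_of_natLE`), so that its integrated form kills `N` and gives a representation of
`L ⧸ N` (`CovRep.quotientRep`).

Conversely, let `ρ` be a representation of `L ⧸ N` on `H`, and `π(a) = ρ(a δ_1)`. For
`b, b' ∈ E s⁻¹` the product `(β_s(b) δ_s)* (β_s(b') δ_s)` is `b* b' δ_{s⁻¹s}`, which agrees with
`b* b' δ_1` modulo `N`. Hence the vectors `π(b)h` and `ρ(β_s(b) δ_s)h` have the same Gram matrix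
(`AlgRep.inner_op_op`), and there is a partial isometry `ν_s` from the essential subspace
`closure (span π(E s⁻¹)H)` onto `closure (span π(E s)H)` with `ν_s π(b)h = ρ(β_s(b) δ_s)h`. That
`(π, ν, H)` is covariant and integrates to `ρ` rests on the identities `π(a)ν_s = ρ(a δ_s)`
(`AlgRep.rep_mul_isom`), `ν_s* = ν_{s⁻¹}` (`AlgRep.star_isom`) and `ν_s ρ(a δ_t) = ρ(β_s(a) δ_{st})`
(`AlgRep.isom_mul_op`). Approximate units are not needed: on its essential subspace an ideal
separates vectors, and `(a δ_s)(a δ_s)* = a a* δ_{ss⁻¹}` shows that `ρ(a δ_s)` has its range in the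
essential subspace of every ideal that contains `a`.

Given the equality of the seminorms, the map `x + N ↦ x` is isometric for them, and `L` is dense in
`L̃` already in the `ℓ¹`-norm, which dominates `‖·‖_c`; the map therefore extends to a
*-isomorphism of the completions (`CStarSeminorm.exists_completion_equiv`).
-/

/-! ### Quotients and completions of *-algebras -/

namespace StarIdeal

variable {B C : Type*} [NonUnitalRing B] [StarRing B] [Module ℂ B]
  [NonUnitalRing C] [StarRing C] [Module ℂ C]

/-- The *-homomorphism on `B ⧸ I` induced by one on `B` that vanishes on `I`. -/
noncomputable def lift (I : StarIdeal B) (φ : B →⋆ₙₐ[ℂ] C) (h : ∀ x ∈ I.toSubmodule, φ x = 0) :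
    I.Quotient →⋆ₙₐ[ℂ] C where
  toFun := I.toSubmodule.liftQ (φ : B →ₗ[ℂ] C) h
  map_smul' c x := map_smul (I.toSubmodule.liftQ (φ : B →ₗ[ℂ] C) h) c x
  map_zero' := map_zero (I.toSubmodule.liftQ (φ : B →ₗ[ℂ] C) h)
  map_add' x y := map_add (I.toSubmodule.liftQ (φ : B →ₗ[ℂ] C) h) x y
  map_mul' := I.cls_surjective.forall₂.2 fun x y => map_mul φ x y
  map_star' := I.cls_surjective.forall.2 fun x => map_star φ x

theorem map_eq_zero_of_mem_span [StarModule ℂ B] {s : Set B} (hs : ∀ x ∈ s, star x ∈ s)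
    (φ : B →⋆ₙₐ[ℂ] C) (h : ∀ x ∈ s, φ x = 0) :
    ∀ x ∈ (StarIdeal.span s hs).toSubmodule, φ x = 0 := by
  intro x hx
  exact (Submodule.mem_sInf.1 hx) (LinearMap.ker (φ : B →ₗ[ℂ] C)) ⟨fun y hy => h y hy,
    fun y hy b => by
      have hy' : φ y = 0 := hy
      exact ⟨show φ (b * y) = 0 by rw [map_mul, hy', mul_zero],
        show φ (y * b) = 0 by rw [map_mul, hy', zero_mul]⟩⟩

end StarIdeal

namespace CStarSeminorm

variable {B C : Type*} [NonUnitalRing B] [StarRing B] [Module ℂ B] [NonUnitalCStarAlgebra C]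

/-- A *-homomorphism from `B` to a C*-algebra that has dense range and induces the seminorm `p`
exhibits that C*-algebra as the completion of `B` with respect to `p`. -/
theorem exists_completion_equiv (p : CStarSeminorm B) (j : B →⋆ₙₐ[ℂ] C)
    (hj : ∀ b, ‖j b‖ = p b) (hd : DenseRange j) :
    ∃ Φ : p.Completion ≃⋆ₐ[ℂ] C, ∀ b, Φ (p.ofB b) = j b := by
  let j' : p.Carrier →+ C := 
    AddMonoidHom.mk' (fun b : p.Carrier => j (b : B)) fun a b => map_add j a b
  have hj' : UniformContinuous j' :=
    uniformContinuous_addMonoidHom_of_continuous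
      (AddMonoidHomClass.continuous_of_bound j' 1 fun x => by rw [one_mul]; exact (hj x).le)
  let F : p.Completion → C := UniformSpace.Completion.extension (α := p.Carrier) j'
  have hF : Continuous F := UniformSpace.Completion.continuous_extension (α := p.Carrier)
  have hFb : ∀ b, F (p.ofB b) = j b := fun b =>
    UniformSpace.Completion.extension_coe (α := p.Carrier) hj' b
  have hadd : ∀ x y, F (x + y) = F x + F y :=
    p.ind₂ (isClosed_eq (by fun_prop) (by fun_prop)) fun a b => by
      rw [← p.ofB_add, hFb, hFb, hFb, map_add]
  have hmul : ∀ x y, F (x * y) = F x * F y :=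
    p.ind₂ (isClosed_eq (by fun_prop) (by fun_prop)) fun a b => by
      rw [← p.ofB_mul, hFb, hFb, hFb, map_mul]
  have hstar : ∀ x, F (star x) = star (F x) :=
    p.ind (isClosed_eq (by fun_prop) (by fun_prop)) fun a => by
      rw [← p.ofB_star, hFb, hFb, map_star]
  have hsmul : ∀ (c : ℂ) x, F (c • x) = c • F x := fun c =>
    p.ind (isClosed_eq (hF.comp (continuous_const_smul c)) (hF.const_smul c)) fun a => by
      rw [← p.ofB_smul, hFb, hFb, map_smul]
  have hnorm : ∀ x, ‖F x‖ = ‖x‖ :=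
    p.ind (isClosed_eq (by fun_prop) (by fun_prop)) fun a => by rw [hFb, hj, p.norm_ofB]
  have hiso : Isometry F :=
    AddMonoidHomClass.isometry_of_norm (AddMonoidHom.mk' F hadd) hnorm
  have hsurj : Function.Surjective F := by
    rw [← Set.range_eq_univ, ← hiso.isClosedEmbedding.isClosed_range.closure_eq]
    exact (hd.mono (by rintro _ ⟨b, rfl⟩; exact ⟨p.ofB b, hFb b⟩)).closure_eq
  exact ⟨{ Equiv.ofBijective F ⟨hiso.injective, hsurj⟩ with
    map_mul' := hmul, map_add' := hadd, map_star' := hstar, map_smul' := hsmul }, hFb⟩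

end CStarSeminorm

/-! ### Operators determined by Gram matrices, and essential subspaces -/

section Hilbert

variable {H : Type*} [NormedAddCommGroup H] [InnerProductSpace ℂ H] [CompleteSpace H]

/-- Two families of vectors with the same Gram matrix are carried one to the other by a bounded
operator with initial space `closure (span v)` and final space `closure (span w)`. -/
theorem exists_clm_of_gram_eq {X : Type*} (v w : X → H)
    (h : ∀ x y, ⟪v x, v y⟫_ℂ = ⟪w x, w y⟫_ℂ) :
    ∃ U : H →L[ℂ] H, (∀ x, U (v x) = w x) ∧
      (∀ z ∈ (Submodule.span ℂ (Set.range v)).topologicalClosureᗮ, U z = 0) ∧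
      ∀ y, U y ∈ (Submodule.span ℂ (Set.range w)).topologicalClosure := by
  let K := (Submodule.span ℂ (Set.range v)).topologicalClosure
  have : CompleteSpace K := (Submodule.isClosed_topologicalClosure _).completeSpace_coe
  let V := Finsupp.linearCombination ℂ v
  let W := Finsupp.linearCombination ℂ w
  have hVK : ∀ f, V f ∈ K := fun f => Submodule.le_topologicalClosure _ (by
    rw [← Finsupp.range_linearCombination]; exact ⟨f, rfl⟩)
  let e : (X →₀ ℂ) →ₗ[ℂ] K := V.codRestrict K hVK
  have hnorm : ∀ f, ‖W f‖ = ‖V f‖ := fun f => by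
    have : ⟪W f, W f⟫_ℂ = ⟪V f, V f⟫_ℂ := by
      simp only [V, W, Finsupp.linearCombination_apply, Finsupp.sum_inner, Finsupp.inner_sum,
        inner_smul_left, inner_smul_right, h]
    rw [← sq_eq_sq₀ (norm_nonneg _) (norm_nonneg _), ← inner_self_eq_norm_sq (𝕜 := ℂ), this,
      inner_self_eq_norm_sq]
  have hdense : DenseRange e := by
    intro x
    rw [closure_subtype, ← Set.range_comp]
    have : Set.range (Subtype.val ∘ e) = (Submodule.span ℂ (Set.range v) : Set H) := by
      rw [← Finsupp.range_linearCombination]; rfl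
    rw [this]
    exact x.2
  have hb : ∃ C, ∀ f, ‖W f‖ ≤ C * ‖e f‖ := ⟨1, fun f => by rw [one_mul, hnorm]; rfl⟩
  have hext : ∀ f, W.extendOfNorm e (e f) = W f := fun f => LinearMap.extendOfNorm_eq hdense hb f
  have hsingle : ∀ x, (e (Finsupp.single x 1) : H) = v x := fun x => by
    change V _ = _
    simp [V]
  refine ⟨(W.extendOfNorm e).comp K.orthogonalProjectionOnto, fun x => ?_,
    fun z hz => ?_, fun y => ?_⟩
  · rw [ContinuousLinearMap.comp_apply, ← hsingle,
      Submodule.orthogonalProjectionOnto_mem_subspace_eq_self, hext]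
    simp [W]
  · rw [ContinuousLinearMap.comp_apply,
      Submodule.orthogonalProjectionOnto_apply_of_mem_orthogonal hz, map_zero]
  · refine hdense.induction_on (p := fun k => W.extendOfNorm e k ∈ _)
      (K.orthogonalProjectionOnto y) ?_ fun f => ?_
    · exact (Submodule.isClosed_topologicalClosure _).preimage (W.extendOfNorm e).continuous
    · rw [hext]
      refine Submodule.le_topologicalClosure _ ?_
      rw [← Finsupp.range_linearCombination]
      exact ⟨f, rfl⟩

variable {A : Type*} [NonUnitalCStarAlgebra A]

/-- The essential subspace `closure (span π(I)H)` of an ideal `I` in a representation `π`. -/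
noncomputable def ClosedIdeal.essSpace (I : ClosedIdeal A) (π : A →⋆ₙₐ[ℂ] (H →L[ℂ] H)) :
    Submodule ℂ H :=
  (Submodule.span ℂ {y | ∃ a ∈ I, ∃ h : H, y = π a h}).topologicalClosure

namespace ClosedIdeal

variable {I : ClosedIdeal A} {π : A →⋆ₙₐ[ℂ] (H →L[ℂ] H)}

theorem inner_rep (a : A) (x y : H) : ⟪π a x, y⟫_ℂ = ⟪x, π (star a) y⟫_ℂ := by
  rw [map_star, ContinuousLinearMap.star_eq_adjoint, ContinuousLinearMap.adjoint_inner_right]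

theorem mem_orthogonal_essSpace {z : H} : z ∈ (I.essSpace π)ᗮ ↔ ∀ a ∈ I, π a z = 0 := by
  rw [essSpace, Submodule.orthogonal_closure]
  constructor
  · intro hz a ha
    rw [← inner_self_eq_zero (𝕜 := ℂ), inner_rep, ← inner_conj_symm,
      hz _ (Submodule.subset_span ⟨_, I.star_mem ha, _, rfl⟩), map_zero]
  · intro hz
    have : Submodule.span ℂ {y | ∃ a ∈ I, ∃ h : H, y = π a h} ≤ (Submodule.span ℂ {z})ᗮ := by
      rw [Submodule.span_le]
      rintro _ ⟨a, ha, h, rfl⟩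
      rw [SetLike.mem_coe, Submodule.mem_orthogonal_singleton_iff_inner_left, inner_rep,
        hz _ (I.star_mem ha), inner_zero_right]
    rw [Submodule.mem_orthogonal]
    exact fun u hu => Submodule.mem_orthogonal_singleton_iff_inner_left.1 (this hu)

instance : CompleteSpace (I.essSpace π) :=
  (Submodule.isClosed_topologicalClosure _).completeSpace_coe

theorem mem_essSpace_iff {y : H} :
    y ∈ I.essSpace π ↔ ∀ z, (∀ a ∈ I, π a z = 0) → ⟪z, y⟫_ℂ = 0 := by
  conv_lhs => rw [← (I.essSpace π).orthogonal_orthogonal, Submodule.mem_orthogonal]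
  simp only [mem_orthogonal_essSpace]

theorem eq_zero_of_mem_essSpace {y : H} (hy : y ∈ I.essSpace π) (h : ∀ a ∈ I, π a y = 0) :
    y = 0 :=
  inner_self_eq_zero.1 (mem_essSpace_iff.1 hy y h)

theorem rep_mem_essSpace (a : A) {y : H} (hy : y ∈ I.essSpace π) : π a y ∈ I.essSpace π := by
  rw [mem_essSpace_iff] at hy ⊢
  intro z hz
  have := hy (π (star a) z) fun b hb => by
    rw [← mul_apply_eq_comp, ← map_mul]
    exact hz _ (I.mul_mem_right _ hb)
  rwa [inner_rep, star_star] at this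

/-- Bounded operators that agree on the vectors `π(a)h`, `a ∈ I`, and on the vectors annihilated by
`π(I)` are equal. -/
theorem clm_ext {F : Type*} [NormedAddCommGroup F] [NormedSpace ℂ F]
    {T T' : H →L[ℂ] F} (h : ∀ a ∈ I, ∀ x, T (π a x) = T' (π a x))
    (h' : ∀ z, (∀ a ∈ I, π a z = 0) → T z = T' z) : T = T' := by
  have h1 : I.essSpace π ≤ LinearMap.ker (T - T').toLinearMap :=
    Submodule.topologicalClosure_minimal _ (Submodule.span_le.2 (by
      rintro _ ⟨a, ha, x, rfl⟩
      exact sub_eq_zero.2 (h a ha x))) (T - T').isClosed_ker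
  ext x
  obtain ⟨y, hy, z, hz, rfl⟩ := (I.essSpace π).exists_add_mem_mem_orthogonal x
  rw [map_add, map_add, h' z (mem_orthogonal_essSpace.1 hz),
    sub_eq_zero.1 (show T y - T' y = 0 from h1 hy)]

end ClosedIdeal

end Hilbert

namespace CStarAction

open InverseMonoid

variable {S A : Type*} [InverseMonoid S] [NonUnitalCStarAlgebra A] {β : CStarAction S A}

/-! ### Covariant representations vanish on `N` -/

namespace CovRep

variable (c : CovRep β)

/-- `π(a)ν_r = π(a)ν_t` for `r ≤ t` and `a ∈ E r`, because `r = r r⁻¹ t` and `ν_{r r⁻¹}` is the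
projection onto the essential subspace of `E r`. -/
theorem π_mul_ν_eq_of_natLE {r t : S} (h : NatLE r t) {a : A} (ha : a ∈ β.E r) :
    c.π a * c.ν r = c.π a * c.ν t := by
  have hr : r * r⁻¹ * t = r := by
    obtain ⟨f, hf, rfl⟩ := h
    have hf' : f * f = f := hf
    calc t * f * (t * f)⁻¹ * t = t * (f * f) * (t⁻¹ * t) := by
          rw [mul_inv_rev', inv_of_idem hf']; simp only [mul_assoc]
      _ = t * t⁻¹ * t * f := by
          rw [hf', mul_assoc, idem_comm hf' (inv_mul_idem t)]; simp only [mul_assoc]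
      _ = t * f := by rw [mul_inv_mul]
  rw [← c.π_mul_ν ha, mul_assoc, mul_assoc, ← c.map_mul, ← c.map_mul, mul_inv_mul, hr]

theorem integrated_eq_zero_of_mem_N :
    ∀ x ∈ β.N.toSubmodule,
      (c.integrated.comp (NonUnitalStarSubalgebraClass.subtype β.finSupp)) x = 0 :=
  StarIdeal.map_eq_zero_of_mem_span _ _ (by
    rintro _ ⟨r, t, h, a, ha, rfl⟩
    rw [_root_.map_sub, sub_eq_zero]
    change c.integratedFun (EllOne.delta r _) = c.integratedFun (EllOne.delta t _)
    rw [c.integratedFun_delta, c.integratedFun_delta, c.π_mul_ν_eq_of_natLE h ha])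

/-- The representation of `L ⧸ N` induced by a covariant representation. -/
noncomputable def quotientRep : StarRep β.AlgCrossedProduct where
  H := c.H
  hom := β.N.lift _ c.integrated_eq_zero_of_mem_N

end CovRep

/-! ### The covariant representation of a representation of `L ⧸ N` -/

namespace AlgRep

variable (ρ : StarRep β.AlgCrossedProduct)

/-- The operator `ρ(a δ_s)`. -/
noncomputable def op (s : S) (a : A) (ha : a ∈ β.E s) : ρ.H →L[ℂ] ρ.H :=
  ρ.hom (β.N.cls (deltaL s ⟨a, ha⟩))

/-- The representation `a ↦ ρ(a δ_1)` of `A`. -/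
noncomputable def rep : A →⋆ₙₐ[ℂ] (ρ.H →L[ℂ] ρ.H) := ρ.hom.comp β.unitHom

theorem op_congr {s t : S} (h : NatLE s t) {a b : A} (hab : a = b) (ha : a ∈ β.E s) :
    op ρ s a ha = op ρ t b (hab ▸ β.mem_of_natLE h ha) := by
  subst hab
  exact congrArg ρ.hom (β.cls_delta_eq h a ha)

theorem natLE_of_eq {s t : S} (h : s = t) : NatLE s t := ⟨1, mul_one 1, by rw [h, mul_one]⟩

theorem natLE_one {f : S} (hf : f * f = f) : NatLE f 1 := ⟨f, hf, (one_mul f).symm⟩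

theorem op_mul (r t : S) (a b : A) (ha : a ∈ β.E r) (hb : b ∈ β.E t) :
    op ρ r a ha * op ρ t b hb = op ρ (r * t) (β.coeff r a b) (β.coeff_mem ha hb) := by
  unfold op
  rw [← _root_.map_mul, ← StarIdeal.cls_mul]
  congr 2
  exact Subtype.ext (EllOne.delta_mul_delta r t ⟨a, ha⟩ ⟨b, hb⟩)

theorem star_op (s : S) (a : A) (ha : a ∈ β.E s) :
    star (op ρ s a ha) = op ρ s⁻¹ (β.act s⁻¹ (star a)) (β.act_inv_mem ((β.E s).star_mem ha)) := by
  unfold op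
  rw [← StarHomClass.map_star, ← StarIdeal.cls_star]
  congr 2
  exact Subtype.ext (EllOne.star_delta s ⟨a, ha⟩)

theorem op_eq_rep {f : S} (hf : f * f = f) (a : A) (ha : a ∈ β.E f) : op ρ f a ha = rep ρ a :=
  op_congr ρ (natLE_one hf) rfl ha

theorem op_one (a : A) : op ρ 1 a (β.E_one a) = rep ρ a := rfl

theorem rep_mul_op (a : A) (s : S) (b : A) (hb : b ∈ β.E s) :
    rep ρ a * op ρ s b hb = op ρ s (a * b) ((β.E s).mul_mem_left a hb) := by
  rw [← op_one, op_mul]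
  refine op_congr ρ (natLE_of_eq (one_mul s)) ?_ _
  rw [coeff, one_inv', act_one, act_one]

theorem op_mul_rep (s : S) (a b : A) (ha : a ∈ β.E s) (h : β.coeff s a b ∈ β.E s) :
    op ρ s a ha * rep ρ b = op ρ s (β.coeff s a b) h := by
  rw [← op_one, op_mul]
  exact op_congr ρ (natLE_of_eq (mul_one s)) rfl _

theorem op_mul_star_self (s : S) (a : A) (ha : a ∈ β.E s) :
    op ρ s a ha * star (op ρ s a ha) = rep ρ (a * star a) := by
  have ha' := (β.E s).star_mem ha
  rw [star_op, op_mul, op_eq_rep ρ (mul_inv_idem s), coeff,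
    ← β.map_mul _ _ (β.inv_inv_mem ha) _ (β.inv_inv_mem ha'),
    β.act_act_inv ((β.E s).mul_mem_left _ ha')]

/-- The range of `ρ(a δ_r)` lies in the essential subspace of every ideal that contains `a`. -/
theorem op_mem_essSpace {r : S} {a : A} (ha : a ∈ β.E r) {I : ClosedIdeal A} (haI : a ∈ I)
    (h : ρ.H) : op ρ r a ha h ∈ I.essSpace (rep ρ) := by
  rw [ClosedIdeal.mem_essSpace_iff]
  intro z hz
  have h0 : star (op ρ r a ha) z = 0 := by
    -- `‖ρ(a δ_r)* z‖² = ⟪z, π(a a*) z⟫`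
    have := ContinuousLinearMap.adjoint_inner_left (op ρ r a ha) (star (op ρ r a ha) z) z
    rw [← inner_self_eq_zero (𝕜 := ℂ)]
    rw [← ContinuousLinearMap.star_eq_adjoint] at this
    rw [this, ← mul_apply_eq_comp, op_mul_star_self, hz _ (I.mul_mem_right _ haI),
      inner_zero_right]
  rw [← ContinuousLinearMap.adjoint_inner_left, ← ContinuousLinearMap.star_eq_adjoint, h0,
    inner_zero_left]

/-- `ρ(a δ_s)` annihilates the vectors annihilated by `π(E s⁻¹)`. -/
theorem op_apply_eq_zero {s : S} {a : A} (ha : a ∈ β.E s) {z : ρ.H}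
    (hz : ∀ c ∈ β.E s⁻¹, rep ρ c z = 0) : op ρ s a ha z = 0 := by
  rw [← inner_self_eq_zero (𝕜 := ℂ), ← ContinuousLinearMap.adjoint_inner_right,
    ← ContinuousLinearMap.star_eq_adjoint, star_op]
  exact ClosedIdeal.mem_essSpace_iff.1
    (op_mem_essSpace ρ _ (β.act_inv_mem ((β.E s).star_mem ha)) _) z hz

theorem inner_op_op (s : S) {b b' : A} (hb : b ∈ β.E s⁻¹) (hb' : b' ∈ β.E s⁻¹) (h h' : ρ.H) :
    ⟪op ρ s (β.act s b) (β.act_mem hb) h, op ρ s (β.act s b') (β.act_mem hb') h'⟫_ℂ =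
      ⟪rep ρ b h, rep ρ b' h'⟫_ℂ := by
  have hbs := (β.E s⁻¹).star_mem hb
  rw [← ContinuousLinearMap.adjoint_inner_right, ← ContinuousLinearMap.star_eq_adjoint,
    ClosedIdeal.inner_rep, ← mul_apply_eq_comp, ← mul_apply_eq_comp, ← _root_.map_mul, star_op,
    op_mul, op_eq_rep ρ (inv_mul_idem s)]
  congr 3
  rw [coeff, inv_inv', β.act_act_inv ((β.E s).star_mem (β.act_mem hb)), ← β.map_star _ _ hb,
    ← β.map_mul _ _ hbs _ hb', β.act_inv_act ((β.E _).mul_mem_left _ hb')]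

theorem exists_partialIsometry (s : S) : ∃ U : ρ.H →L[ℂ] ρ.H,
    (∀ (b : A) (hb : b ∈ β.E s⁻¹) (h : ρ.H),
      U (rep ρ b h) = op ρ s (β.act s b) (β.act_mem hb) h) ∧
    (∀ z, (∀ a ∈ β.E s⁻¹, rep ρ a z = 0) → U z = 0) ∧
    ∀ y, U y ∈ (β.E s).essSpace (rep ρ) := by
  obtain ⟨U, h1, h2, h3⟩ := exists_clm_of_gram_eq
    (fun p : {b // b ∈ β.E s⁻¹} × ρ.H => rep ρ p.1.1 p.2)
    (fun p => op ρ s (β.act s p.1.1) (β.act_mem p.1.2) p.2)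
    fun p q => (inner_op_op ρ s p.1.2 q.1.2 p.2 q.2).symm
  refine ⟨U, fun b hb h => h1 (⟨b, hb⟩, h), fun z hz => h2 z ?_, fun y => ?_⟩
  · have : Set.range (fun p : {b // b ∈ β.E s⁻¹} × ρ.H => rep ρ p.1.1 p.2) =
        {y | ∃ a ∈ β.E s⁻¹, ∃ h : ρ.H, y = rep ρ a h} := by
      ext y
      exact ⟨fun ⟨p, hp⟩ => ⟨p.1.1, p.1.2, p.2, hp.symm⟩,
        fun ⟨a, ha, h, hy⟩ => ⟨(⟨a, ha⟩, h), hy.symm⟩⟩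
    rw [this]
    exact ClosedIdeal.mem_orthogonal_essSpace.2 hz
  · refine Submodule.topologicalClosure_minimal _ (Submodule.span_le.2 ?_)
      (Submodule.isClosed_topologicalClosure _) (h3 y)
    rintro _ ⟨p, rfl⟩
    exact op_mem_essSpace ρ _ (β.act_mem p.1.2) _

/-- The partial isometry `ν_s`, determined by `ν_s π(b)h = ρ(β_s(b) δ_s)h` for `b ∈ E s⁻¹` and by
`ν_s = 0` on the orthogonal complement of `π(E s⁻¹)H`. -/
noncomputable def isom (s : S) : ρ.H →L[ℂ] ρ.H := (exists_partialIsometry ρ s).choose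

theorem isom_mul_rep (s : S) {b : A} (hb : b ∈ β.E s⁻¹) :
    isom ρ s * rep ρ b = op ρ s (β.act s b) (β.act_mem hb) :=
  ContinuousLinearMap.ext fun h => (exists_partialIsometry ρ s).choose_spec.1 b hb h

theorem isom_apply_eq_zero (s : S) {z : ρ.H} (hz : ∀ a ∈ β.E s⁻¹, rep ρ a z = 0) :
    isom ρ s z = 0 := (exists_partialIsometry ρ s).choose_spec.2.1 z hz

theorem isom_mem_essSpace (s : S) (y : ρ.H) : isom ρ s y ∈ (β.E s).essSpace (rep ρ) :=
  (exists_partialIsometry ρ s).choose_spec.2.2 y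

theorem rep_mul_isom (s : S) {a : A} (ha : a ∈ β.E s) : rep ρ a * isom ρ s = op ρ s a ha := by
  refine ClosedIdeal.clm_ext (I := β.E s⁻¹) (π := rep ρ) (fun b hb x => ?_) fun z hz => ?_
  · have h : β.coeff s a b = a * β.act s b := by
      rw [coeff, β.map_mul _ _ (β.act_inv_mem ha) _ hb, β.act_act_inv ha]
    rw [← mul_apply_eq_comp, ← mul_apply_eq_comp, mul_assoc, isom_mul_rep ρ s hb, rep_mul_op,
      op_mul_rep ρ s a b ha (h ▸ (β.E s).mul_mem_right _ ha), op_congr ρ (natLE_of_eq rfl) h]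
  · rw [mul_apply_eq_comp, isom_apply_eq_zero ρ s hz, map_zero, op_apply_eq_zero ρ ha hz]

theorem star_isom (s : S) : star (isom ρ s) = isom ρ s⁻¹ := by
  refine ClosedIdeal.clm_ext (I := β.E s) (π := rep ρ) (fun b hb x => ?_) fun z hz => ?_
  · have hb' := (β.E s).star_mem hb
    rw [← mul_apply_eq_comp, ← mul_apply_eq_comp, isom_mul_rep ρ s⁻¹ (β.inv_inv_mem hb)]
    congr 1
    have e : rep ρ b = star (rep ρ (star b)) := by rw [← StarHomClass.map_star, star_star]
    rw [e, ← star_mul, rep_mul_isom ρ s hb', star_op]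
    exact op_congr ρ (natLE_of_eq rfl) (by rw [star_star]) _
  · rw [isom_apply_eq_zero ρ s⁻¹ (by rwa [inv_inv']), ← inner_self_eq_zero (𝕜 := ℂ),
      ContinuousLinearMap.star_eq_adjoint, ContinuousLinearMap.adjoint_inner_left]
    exact ClosedIdeal.mem_essSpace_iff.1 (isom_mem_essSpace ρ s _) z hz

/-- `ν_s ρ(a δ_t) = ρ(β_s(a) δ_{st})` for `a ∈ E s⁻¹ ∩ E t`. -/
theorem isom_mul_op (s t : S) {a : A} (ha : a ∈ β.E s⁻¹) (hat : a ∈ β.E t) :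
    isom ρ s * op ρ t a hat = op ρ (s * t) (β.act s a) (β.act_mul_mem ha hat) := by
  ext h
  rw [← sub_eq_zero]
  -- both vectors lie in the essential subspace of `E s`, where `π(E s)` separates vectors
  refine ClosedIdeal.eq_zero_of_mem_essSpace (I := β.E s) (π := rep ρ)
    (Submodule.sub_mem _ (isom_mem_essSpace ρ s _) (op_mem_essSpace ρ _ (β.act_mem ha) h))
    fun d hd => ?_
  rw [_root_.map_sub, sub_eq_zero, ← mul_apply_eq_comp, ← mul_apply_eq_comp, ← mul_assoc,
    rep_mul_isom ρ s hd, op_mul, rep_mul_op]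
  refine congrArg (fun T : ρ.H →L[ℂ] ρ.H => T h) (op_congr ρ (natLE_of_eq rfl) ?_ _)
  rw [coeff, β.map_mul _ _ (β.act_inv_mem hd) _ ha, β.act_act_inv hd]

theorem isom_mul (s t : S) : isom ρ (s * t) = isom ρ s * isom ρ t := by
  refine ClosedIdeal.clm_ext (I := β.E (s * t)⁻¹) (π := rep ρ) (fun b hb x => ?_) fun z hz => ?_
  · obtain ⟨hbt, hbs⟩ := (β.comp_domain s t b).1 hb
    rw [← mul_apply_eq_comp, ← mul_apply_eq_comp, isom_mul_rep ρ _ hb, mul_assoc,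
      isom_mul_rep ρ t hbt, isom_mul_op ρ s t hbs]
    exact congrArg (fun T : ρ.H →L[ℂ] ρ.H => T x)
      (op_congr ρ (natLE_of_eq rfl) (β.comp_apply s t b hb) _)
  · rw [isom_apply_eq_zero ρ _ hz, mul_apply_eq_comp, isom_apply_eq_zero ρ s fun c hc => ?_]
    -- `π(c)ν_t z` lies in the essential subspace of `E t` and is annihilated by `π(E t)`
    refine ClosedIdeal.eq_zero_of_mem_essSpace (I := β.E t) (π := rep ρ)
      (ClosedIdeal.rep_mem_essSpace c (isom_mem_essSpace ρ t z)) fun d hd => ?_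
    have hdct : d * c ∈ β.E t := (β.E t).mul_mem_right _ hd
    have hdcs : d * c ∈ β.E s⁻¹ := (β.E _).mul_mem_left _ hc
    have hm : β.act t⁻¹ (d * c) ∈ β.E (s * t)⁻¹ := by
      rw [mul_inv_rev']; exact β.act_mul_mem (β.inv_inv_mem hdct) hdcs
    have e : rep ρ (d * c) * isom ρ t = isom ρ t * rep ρ (β.act t⁻¹ (d * c)) := by
      rw [rep_mul_isom ρ t hdct, isom_mul_rep ρ t (β.act_inv_mem hdct)]
      exact op_congr ρ (natLE_of_eq rfl) (β.act_act_inv hdct).symm _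
    rw [← mul_apply_eq_comp, ← mul_apply_eq_comp, ← _root_.map_mul, e,
      mul_apply_eq_comp, hz _ hm, _root_.map_zero]

/-- `ρ(a δ_s) ν_{s⁻¹} = π(a)` for `a ∈ E s`. -/
theorem op_mul_isom_inv (s : S) {a : A} (ha : a ∈ β.E s) :
    op ρ s a ha * isom ρ s⁻¹ = rep ρ a := by
  rw [← rep_mul_isom, mul_assoc, ← isom_mul, rep_mul_isom ρ _ (β.mem_mul_inv_self ha),
    op_eq_rep ρ (mul_inv_idem s)]

/-- The covariance condition. -/
theorem isom_mul_rep_mul_isom_inv (s : S) {a : A} (ha : a ∈ β.E s⁻¹) :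
    isom ρ s * rep ρ a * isom ρ s⁻¹ = rep ρ (β.act s a) := by
  rw [isom_mul_rep ρ s ha, op_mul_isom_inv]

theorem ker_isom (s : S) :
    LinearMap.ker (isom ρ s).toLinearMap = ((β.E s⁻¹).essSpace (rep ρ))ᗮ := by
  ext z
  rw [ClosedIdeal.mem_orthogonal_essSpace, LinearMap.mem_ker]
  refine ⟨fun hz a ha => ?_, fun hz => isom_apply_eq_zero ρ s hz⟩
  have hz' : isom ρ s z = 0 := hz
  rw [← op_mul_isom_inv ρ s⁻¹ ha, inv_inv', mul_apply_eq_comp, hz', _root_.map_zero]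

theorem range_isom (s : S) :
    LinearMap.range (isom ρ s).toLinearMap = (β.E s).essSpace (rep ρ) := by
  refine le_antisymm (by rintro _ ⟨y, rfl⟩; exact isom_mem_essSpace ρ s y) fun y hy => ?_
  have h : (β.E s).essSpace (rep ρ) ≤
      LinearMap.ker (isom ρ s * isom ρ s⁻¹ - 1 : ρ.H →L[ℂ] ρ.H).toLinearMap :=
    Submodule.topologicalClosure_minimal _ (Submodule.span_le.2 (by
      rintro _ ⟨a, ha, x, rfl⟩
      change (isom ρ s * isom ρ s⁻¹) (rep ρ a x) - rep ρ a x = 0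
      rw [sub_eq_zero, ← mul_apply_eq_comp, mul_assoc, isom_mul_rep ρ s⁻¹ (β.inv_inv_mem ha),
        isom_mul_op ρ s s⁻¹ (β.act_inv_mem ha), op_eq_rep ρ (mul_inv_idem s), β.act_act_inv ha]))
      (ContinuousLinearMap.isClosed_ker _)
  exact ⟨isom ρ s⁻¹ y, sub_eq_zero.1 (h hy)⟩

/-- The covariant representation `(π, ν, H)` of a representation of `L ⧸ N`. -/
noncomputable def covRep : CovRep β where
  H := ρ.H
  π := rep ρ
  ν := isom ρ
  partialIsometry s := by rw [star_isom, ← isom_mul, ← isom_mul, mul_inv_mul]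
  map_mul := isom_mul ρ
  covariant s _ ha := isom_mul_rep_mul_isom_inv ρ s ha
  initial s := by
    rw [ker_isom, Submodule.orthogonal_orthogonal]; rfl
  final s := range_isom ρ s

theorem covRep_integrated (x : β.L) :
    (covRep ρ).integrated (x : β.EllOne) = ρ.hom (β.N.cls x) := by
  let f : β.L →+ (ρ.H →L[ℂ] ρ.H) := 
    AddMonoidHom.mk' (fun y => (covRep ρ).integrated (y : β.EllOne))
    fun y z => _root_.map_add (covRep ρ).integrated (y : β.EllOne) z
  let g : β.L →+ (ρ.H →L[ℂ] ρ.H) := AddMonoidHom.mk' (fun y => ρ.hom (β.N.cls y))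
    fun y z => _root_.map_add ρ.hom (β.N.cls y) (β.N.cls z)
  change f x = g x
  rw [sum_delta x, _root_.map_sum, _root_.map_sum]
  refine Finset.sum_congr rfl fun s _ => ?_
  exact ((covRep ρ).integratedFun_delta s _).trans (rep_mul_isom ρ s (x.1.mem s))

end AlgRep

/-! ### Comparison of the two crossed products -/

theorem algSeminorm_cls (x : β.L) :
    β.algSeminorm (β.N.cls x) = β.siebenSeminorm (x : β.EllOne) := by
  apply le_antisymm
  · exact ciSup_le fun ρ => (congrArg norm (AlgRep.covRep_integrated ρ x)).symm.le.trans
      (le_ciSup (β.bddAbove_integrated (x : β.EllOne)) (AlgRep.covRep ρ))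
  · exact ciSup_le fun c => le_ciSup (β.bddAbove_hom (β.N.cls x)) c.quotientRep

theorem siebenSeminorm_le_norm (x : β.EllOne) : β.siebenSeminorm x ≤ ‖x‖ :=
  ciSup_le fun c => c.norm_integratedFun_le x

theorem denseRange_toSieben :
    DenseRange fun x : β.L => β.toSiebenCrossedProduct (x : β.EllOne) := by
  have hL : DenseRange ((↑) : β.L → β.EllOne) := by
    intro x
    exact mem_closure_of_tendsto (EllOne.hasSum_delta x) (Filter.Eventually.of_forall fun F =>
      ⟨∑ s ∈ F, deltaL s ⟨x s, x.mem s⟩, AddSubmonoidClass.coe_finsetSum _ _⟩)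
  have hc : Continuous β.toSiebenCrossedProduct :=
    AddMonoidHomClass.continuous_of_bound β.siebenSeminorm.toCompletion 1 fun x => by
      rw [one_mul]
      exact (β.siebenSeminorm.norm_ofB x).le.trans (siebenSeminorm_le_norm x)
  exact β.siebenSeminorm.denseRange_ofB.comp hL hc

end CStarAction

theorem theorem5p7 {S A : Type*} [InverseMonoid S] [NonUnitalCStarAlgebra A]
    (β : CStarAction S A) :
    (∀ x : β.L, β.algSeminorm (β.N.cls x) = β.siebenSeminorm (x : β.EllOne)) ∧
    ∃ Φ : β.PartialCrossedProduct ≃⋆ₐ[ℂ] β.SiebenCrossedProduct,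
      ∀ x : β.L, Φ (β.toPartialCrossedProduct x) = β.toSiebenCrossedProduct (x : β.EllOne) := by
  refine ⟨CStarAction.algSeminorm_cls, ?_⟩
  have hnorm : ∀ x : β.L, ‖β.toSiebenCrossedProduct (x : β.EllOne)‖ = β.algSeminorm (β.N.cls x) :=
    fun x => (β.siebenSeminorm.norm_ofB _).trans (CStarAction.algSeminorm_cls x).symm
  let φ : β.L →⋆ₙₐ[ℂ] β.SiebenCrossedProduct :=
    β.siebenSeminorm.toCompletion.comp (NonUnitalStarSubalgebraClass.subtype β.finSupp)
  have hφ : ∀ x ∈ β.N.toSubmodule, φ x = 0 := fun x hx => by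
    have h0 : β.N.cls x = 0 := by
      rw [← StarIdeal.cls_zero, StarIdeal.cls_eq, sub_zero]; exact hx
    have : ‖φ x‖ = β.algSeminorm (β.N.cls x) := hnorm x
    rw [h0] at this
    exact norm_eq_zero.1 (this.trans (map_zero β.algSeminorm.toSeminorm))
  obtain ⟨Φ, hΦ⟩ := β.algSeminorm.exists_completion_equiv (β.N.lift φ hφ)
    (β.N.cls_surjective.forall.2 hnorm)
    (CStarAction.denseRange_toSieben.mono (by rintro _ ⟨x, rfl⟩; exact ⟨β.N.cls x, rfl⟩))
  exact ⟨Φ, fun x => hΦ (β.N.cls x)⟩
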